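/- Let $d\ge 1$, $n\ge 1$, let $\mathcal X$ be a subset of a real normed space, and let $f:\mathbb R^d\times\mathcal X\to\mathbb R$. Assume: (i) for every $x\in\mathcal X$ the function $f(\cdot,x)$ is differentiable, and there are $K_1,K_2>0$ with $\|\nabla f(\theta,x)-\nabla f(\hat\theta,\hat x)\|\le K_1\|\theta-\hat\theta\|+K_2\|x-\hat x\|(\|\theta\|+\|\hat\theta\|+1)$ for all $\theta,\hat\theta\in\mathbb R^d$ and $x,\hat x\in\mathcal X$; (ii) there are $B,m,K>0$ with $\|\nabla f(0,x)\|\le B$ and $\langle\nabla f(\theta_1,x)-\nabla f(\theta_2,x),\theta_1-\theta_2\rangle\ge m\|\theta_1-\theta_2\|^2-K$ for all $\theta_1,\theta_2\in\mathbb R^d$ and $x\in\mathcal X$; (iii) (bounded data) $\|x-\hat x\|\le D<\infty$ for all $x,\hat x\in\mathcal X$; (iv) (universal stable point) $\vartheta_\star\in\mathbb R^d$ satisfies $\nabla f(\vartheta_\star,x)=0$ for every $x\in\mathcal X$. Let $\alpha\in(1,2)$, $0<p<\min(\tfrac12,\alpha-1)$, $\eta>0$, $\sigma>0$, and let $\xi$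 be a random vector in $\mathbb R^d$ with the rotationally invariant $\alpha$-stable law $\mathbb E\,e^{\mathrm i u^\top\xi}=e^{-\|u\|^\alpha}$, $u\in\mathbb R^d$. Let $X=(x_1,\dots,x_n)$ and $\hat X=(\hat x_1,\dots,\hat x_n)$ in $\mathcal X^n$ differ in at most one entry, and put $F(\theta,X)=\frac1n\sum_{i=1}^n f(\theta,x_i)$. Let $P$ and $\hat P$ be the transition kernels of the noisy gradient descent chains $\theta_k=\theta_{k-1}-\eta\nabla F(\theta_{k-1},X)+\sigma\xi_k$ and $\hat\theta_k=\hat\theta_{k-1}-\eta\nabla F(\hat\theta_{k-1},\hat X)+\sigma\xi_k$ with $\xi_k$ i.i.d. copies of $\xi$; that is, $P(\theta,\cdot)$ is the law of $\theta-\eta\nabla F(\theta,X)+\sigma\xi$, and similarly for $\hat P$. Set $$V_p(\theta)=(1+\|\theta-\vartheta_\star\|^2)^{p/2},\qquad \hat V_p(\theta)=V_{1+p}(\theta)=(1+\|\theta-\vartheta_\star\|^2)^{(1+p)/2},$$ and $\|\mu-\nu\|_V=\sup_{|g|\le V}\left|\int g\,d\mu-\int g\,d\nu\right|$, the supremum being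 over measurable $g$. Then for every $\theta$ the function $V_p$ is integrable with respect to $P(\theta,\cdot)$ and $\hat P(\theta,\cdot)$, and $$\sup_{\theta\in\mathbb R^d}\frac{\|P(\theta,\cdot)-\hat P(\theta,\cdot)\|_{V_p}}{\hat V_p(\theta)}\le\frac{C_\gamma}{n},\qquad C_\gamma=(C_6+C_7)(2+\|\vartheta_\star\|),$$ where $C_\gamma$ does not depend on $n$ (and is positive when $D>0$), with $$C_6=\frac{8K_2D\eta}{\sigma\sqrt\pi}\,\Gamma\!\left(1+\tfrac1\alpha\right)\left(1-2\eta m+\eta^2K_1^2\right)^{p/2},$$ $$C_7=\frac{4K_2D\eta}{\sigma}\left(\frac{2}{\sqrt\pi}\,\Gamma\!\left(1+\tfrac1\alpha\right)\left(\sqrt2+(2\eta K)^{p/2}\right)+\frac{\Gamma\left(\frac{1+\alpha-p}{\alpha}\right)}{\Gamma\left(\frac{3-p}{2}\right)}\,\sigma^p\,2^{p/2}\left(\frac{\Gamma(p+\frac d2)}{\Gamma(\frac d2)}\right)^{1/2}\right).$$ -/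

import Mathlib

open MeasureTheory ProbabilityTheory
open scoped ENNReal

namespace HeavyTailedGD

noncomputable section

/-- A probability measure on `ℝ^d` is rotationally invariant `α`-stable (with unit scale) if its
characteristic function is `u ↦ exp (-‖u‖ ^ α)`. -/
def IsRotInvStable {d : ℕ} (α : ℝ) (ν : Measure (EuclideanSpace ℝ (Fin d))) : Prop :=
  ∀ u, charFun ν u = ((Real.exp (-(‖u‖ ^ α)) : ℝ) : ℂ)

/-- Pseudo-Lipschitz gradients: for every `x ∈ 𝒳` the loss `f (·, x)` is differentiable, and
`‖∇f(θ,x) - ∇f(θ',x')‖ ≤ K₁ ‖θ - θ'‖ + K₂ ‖x - x'‖ (‖θ‖ + ‖θ'‖ + 1)`. -/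
structure PseudoLipschitzGradient {d : ℕ} {S : Type*} [NormedAddCommGroup S]
    (f : EuclideanSpace ℝ (Fin d) → S → ℝ) (𝒳 : Set S) (K₁ K₂ : ℝ) : Prop where
  K₁_pos : 0 < K₁
  K₂_pos : 0 < K₂
  differentiable : ∀ x ∈ 𝒳, Differentiable ℝ (fun θ => f θ x)
  bound : ∀ θ θ' : EuclideanSpace ℝ (Fin d), ∀ x ∈ 𝒳, ∀ x' ∈ 𝒳,
    ‖gradient (fun w => f w x) θ - gradient (fun w => f w x') θ'‖
      ≤ K₁ * ‖θ - θ'‖ + K₂ * ‖x - x'‖ * (‖θ‖ + ‖θ'‖ + 1)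

/-- Uniform dissipativity of the loss, with bounded gradients at the origin. -/
structure UniformlyDissipative {d : ℕ} {S : Type*}
    (f : EuclideanSpace ℝ (Fin d) → S → ℝ) (𝒳 : Set S) (B m K : ℝ) : Prop where
  B_pos : 0 < B
  m_pos : 0 < m
  K_pos : 0 < K
  gradient_zero_le : ∀ x ∈ 𝒳, ‖gradient (fun w => f w x) 0‖ ≤ B
  dissipative : ∀ θ₁ θ₂ : EuclideanSpace ℝ (Fin d), ∀ x ∈ 𝒳,
    m * ‖θ₁ - θ₂‖ ^ 2 - K
      ≤ inner ℝ (gradient (fun w => f w x) θ₁ - gradient (fun w => f w x) θ₂) (θ₁ - θ₂)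

/-- `ϑ` is a universal stable point: every `f (·, x)`, `x ∈ 𝒳`, has vanishing gradient there. -/
def IsUniversalStablePoint {d : ℕ} {S : Type*}
    (f : EuclideanSpace ℝ (Fin d) → S → ℝ) (𝒳 : Set S) (ϑ : EuclideanSpace ℝ (Fin d)) : Prop :=
  ∀ x ∈ 𝒳, gradient (fun w => f w x) ϑ = 0

/-- Two data sets of size `n` are neighboring if they agree except possibly at one index. -/
def Neighboring {S : Type*} {n : ℕ} (X Y : Fin n → S) : Prop :=
  ∃ i, ∀ j, j ≠ i → X j = Y j

/-- The empirical risk `F(θ, X) = (1/n) ∑ᵢ f(θ, xᵢ)`. -/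
def empiricalRisk {d n : ℕ} {S : Type*} (f : EuclideanSpace ℝ (Fin d) → S → ℝ)
    (X : Fin n → S) (θ : EuclideanSpace ℝ (Fin d)) : ℝ :=
  (1 / (n : ℝ)) * ∑ i, f θ (X i)

theorem measurable_gradient {d : ℕ} (g : EuclideanSpace ℝ (Fin d) → ℝ) :
    Measurable (gradient g) :=
  (InnerProductSpace.toDual ℝ (EuclideanSpace ℝ (Fin d))).symm.continuous.measurable.comp
    (measurable_fderiv ℝ g)

/-- One step of noisy gradient descent: `θ - η ∇F(θ, X) + σ z`. -/
def gdStep {d n : ℕ} {S : Type*} (f : EuclideanSpace ℝ (Fin d) → S → ℝ) (η σ : ℝ)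
    (X : Fin n → S) (θ z : EuclideanSpace ℝ (Fin d)) : EuclideanSpace ℝ (Fin d) :=
  θ - η • gradient (empiricalRisk f X) θ + σ • z

theorem measurable_gdStep {d n : ℕ} {S : Type*} (f : EuclideanSpace ℝ (Fin d) → S → ℝ)
    (η σ : ℝ) (X : Fin n → S) :
    Measurable (fun q : EuclideanSpace ℝ (Fin d) × EuclideanSpace ℝ (Fin d) =>
      gdStep f η σ X q.1 q.2) := by
  unfold gdStep
  exact (measurable_fst.sub (((measurable_gradient _).comp measurable_fst).const_smul η)).add
    (measurable_snd.const_smul σ)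

/-- The transition kernel of the noisy gradient descent chain
`θ_k = θ_{k-1} - η ∇F(θ_{k-1}, X) + σ ξ_k` with i.i.d. noise `ξ_k` of law `ν`:
`P(θ, ·)` is the law of `θ - η ∇F(θ, X) + σ ξ` for `ξ` of law `ν`. -/
def gdKernel {d n : ℕ} {S : Type*} (f : EuclideanSpace ℝ (Fin d) → S → ℝ) (η σ : ℝ)
    (ν : Measure (EuclideanSpace ℝ (Fin d))) [SFinite ν] (X : Fin n → S) :
    Kernel (EuclideanSpace ℝ (Fin d)) (EuclideanSpace ℝ (Fin d)) where
  toFun θ := ν.map (gdStep f η σ X θ)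
  measurable' := by
    refine Measure.measurable_of_measurable_coe _ fun s hs => ?_
    have h : ∀ θ, (ν.map (gdStep f η σ X θ)) s
        = ν (Prod.mk θ ⁻¹' ((fun q : EuclideanSpace ℝ (Fin d) × EuclideanSpace ℝ (Fin d) =>
            gdStep f η σ X q.1 q.2) ⁻¹' s)) := fun θ =>
      Measure.map_apply ((measurable_gdStep f η σ X).comp measurable_prodMk_left) hs
    simp only [h]
    exact measurable_measure_prodMk_left (measurable_gdStep f η σ X hs)

/-- The Lyapunov function `V_p(θ) = (1 + ‖θ - ϑ‖²)^{p/2}`. -/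
def lyapunov {d : ℕ} (ϑ : EuclideanSpace ℝ (Fin d)) (p : ℝ) (θ : EuclideanSpace ℝ (Fin d)) : ℝ :=
  (1 + ‖θ - ϑ‖ ^ 2) ^ (p / 2)

/-- The `V`-norm `‖μ - ν‖_V`: the supremum of `|∫ g dμ - ∫ g dν|` over measurable `g` with
`|g| ≤ V`. It is meant for `V` integrable with respect to both measures. -/
def vNorm {d : ℕ} (V : EuclideanSpace ℝ (Fin d) → ℝ)
    (μ ν : Measure (EuclideanSpace ℝ (Fin d))) : ℝ≥0∞ :=
  ⨆ (g : EuclideanSpace ℝ (Fin d) → ℝ) (_ : Measurable g) (_ : ∀ y, |g y| ≤ V y),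
    ENNReal.ofReal |(∫ y, g y ∂μ) - ∫ y, g y ∂ν|

/-- The explicit constant `C_γ`; it does not depend on the number of data points. -/
def cGamma (d : ℕ) (α p η σ m K K₁ K₂ D : ℝ) (ϑ : EuclideanSpace ℝ (Fin d)) : ℝ :=
  let C₁ := 2 * K₂ * D * η / σ
  let C₂ := 2 / √Real.pi * Real.Gamma (1 + 1 / α)
  let C₃ := Real.Gamma ((1 + α - p) / α) / Real.Gamma ((3 - p) / 2)
  let C₄ := 2 * C₁ * C₂
  let C₅ := 2 * C₁ * C₃
  let Cp := (2 : ℝ) ^ p * (Real.Gamma (p + (d : ℝ) / 2) / Real.Gamma ((d : ℝ) / 2))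
  let C₆ := C₄ * (1 - 2 * η * m + η ^ 2 * K₁ ^ 2) ^ (p / 2)
  let C₇ := C₄ * √2 + C₄ * (2 * η * K) ^ (p / 2) + C₅ * σ ^ p * √Cp
  (C₆ + C₇) * (2 + ‖ϑ‖)

end

end HeavyTailedGD

namespace HeavyTailedGD

open Filter Topology Set

noncomputable section

/-! Both kernels at `θ` are translates of one scaled stable law, so the claim bounds the cost of
moving its centre. The two centres are `θ` minus the gradient steps; neighbouring data differ in one
summand of the empirical gradient, so the centres are `O((‖θ‖ + 1) / n)` apart.

The cost of a shift is found by subordination (`IsRotInvStable.eq_map_prod`): the stable vector is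
`√(2S) Z` with `S` one-sided `α/2`-stable and `Z` standard Gaussian. Given `S`, the law is Gaussian
with scale `t = σ √(2S)`; differentiating its density along the shift, Cauchy–Schwarz and `V_p(u +
y) ≤ V_p(u) + ‖y‖ ^ p` give a bound `‖b - a‖ / t * (A + t ^ p √Cp)`, where `A` bounds `V_p` between
the centres (`enorm_integral_gaussian_sub_le`). Averaging over `S` needs only its moments of order
`-1/2` and `-(1-p)/2`, read off the Laplace transform; they produce the Gamma quotients
(`IsRotInvStable.enorm_integral_sub_le`).

Dissipativity around the common stable point bounds `A` by a multiple of `V_p(θ)`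
(`lyapunov_segment_gradientStep_le`), while `‖θ‖ + 1/2` is at most `2 + ‖ϑ‖` times `V_1(θ)`; the
product `V_1 V_p = V_{1+p}` is the weight in the denominator.

The variable `S` is constructed as a weak limit of normalized sums of Pareto variables
(`exists_oneSidedStable`). Only its Laplace transform is ever used. -/

/-! ### One-sided stable laws -/

/-- The density `(1 - e^{-x}) x^{-(1+q)}` whose integral over `(0, ∞)` normalizes the Lévy measure
of the one-sided `q`-stable law. -/
def levyIntegrand (q x : ℝ) : ℝ := (1 - Real.exp (-x)) * x ^ (-(1 + q))

theorem measurable_levyIntegrand (q : ℝ) : Measurable (levyIntegrand q) := by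
  unfold levyIntegrand
  fun_prop

theorem levyIntegrand_pos (q : ℝ) {x : ℝ} (hx : 0 < x) : 0 < levyIntegrand q x := by
  unfold levyIntegrand
  have h : Real.exp (-x) < 1 := Real.exp_lt_one_iff.2 (by linarith)
  have := Real.rpow_pos_of_pos hx (-(1 + q))
  exact mul_pos (by linarith) this

theorem integrableOn_levyIntegrand {q : ℝ} (hq : 0 < q) (hq' : q < 1) :
    IntegrableOn (levyIntegrand q) (Ioi 0) := by
  have h1 : IntegrableOn (levyIntegrand q) (Ioc 0 1) := by
    have hb : IntegrableOn (fun x : ℝ => x ^ (-q)) (Ioc 0 1) := by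
      rw [integrableOn_Ioc_iff_integrableOn_Ioo]
      exact (intervalIntegral.integrableOn_Ioo_rpow_iff one_pos).2 (by linarith)
    refine Integrable.mono' hb (measurable_levyIntegrand q).aestronglyMeasurable ?_
    refine (ae_restrict_iff' measurableSet_Ioc).2 (Eventually.of_forall fun x hx => ?_)
    rw [Real.norm_of_nonneg (levyIntegrand_pos q hx.1).le, levyIntegrand]
    have hle : 1 - Real.exp (-x) ≤ x := by linarith [Real.add_one_le_exp (-x)]
    calc (1 - Real.exp (-x)) * x ^ (-(1 + q)) ≤ x * x ^ (-(1 + q)) :=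
          mul_le_mul_of_nonneg_right hle (Real.rpow_nonneg hx.1.le _)
      _ = x ^ (-q) := by
          rw [← Real.rpow_one_add' hx.1.le (by linarith)]
          congr 1
          ring
  have h2 : IntegrableOn (levyIntegrand q) (Ioi 1) := by
    have hb : IntegrableOn (fun x : ℝ => x ^ (-(1 + q))) (Ioi 1) :=
      integrableOn_Ioi_rpow_of_lt (by linarith) one_pos
    refine Integrable.mono' hb (measurable_levyIntegrand q).aestronglyMeasurable ?_
    refine (ae_restrict_iff' measurableSet_Ioi).2 (Eventually.of_forall fun x hx => ?_)
    have hx0 : (0 : ℝ) < x := lt_trans one_pos hx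
    rw [Real.norm_of_nonneg (levyIntegrand_pos q hx0).le, levyIntegrand]
    exact mul_le_of_le_one_left (Real.rpow_nonneg hx0.le _) (by linarith [Real.exp_pos (-x)])
  rw [← Ioc_union_Ioi_eq_Ioi (zero_le_one (α := ℝ))]
  exact h1.union h2

theorem integral_levyIntegrand_pos {q : ℝ} (hq : 0 < q) (hq' : q < 1) :
    0 < ∫ x in Ioi (0 : ℝ), levyIntegrand q x := by
  refine (setIntegral_pos_iff_support_of_nonneg_ae ?_ (integrableOn_levyIntegrand hq hq')).2 ?_
  · exact (ae_restrict_iff' measurableSet_Ioi).2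
      (Eventually.of_forall fun x hx => (levyIntegrand_pos q hx).le)
  · have : Function.support (levyIntegrand q) ∩ Ioi 0 = Ioi 0 :=
      inter_eq_right.2 fun x hx => (levyIntegrand_pos q hx).ne'
    rw [this]
    simp

/-- The Laplace transform of the Pareto law near the origin. -/
theorem one_sub_laplace_pareto {a l : ℝ} (ha : 0 < a) (hl : 0 < l) :
    1 - ∫ x, Real.exp (-(l * |x|)) ∂(paretoMeasure 1 a)
      = a * l ^ a * ∫ y in Ioi l, levyIntegrand a y := by
  have : IsProbabilityMeasure (paretoMeasure 1 a) := isProbabilityMeasure_paretoMeasure one_pos ha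
  have hint : Integrable (fun x => Real.exp (-(l * |x|))) (paretoMeasure 1 a) := by
    refine Integrable.of_bound (by fun_prop) 1 (Eventually.of_forall fun x => ?_)
    rw [Real.norm_of_nonneg (Real.exp_pos _).le]
    exact Real.exp_le_one_iff.2 (by have := abs_nonneg x; nlinarith)
  have h1 : 1 - ∫ x, Real.exp (-(l * |x|)) ∂(paretoMeasure 1 a)
      = ∫ x, (1 - Real.exp (-(l * |x|))) ∂(paretoMeasure 1 a) := by
    rw [integral_sub (integrable_const _) hint]
    simp
  rw [h1, paretoMeasure, integral_withDensity_eq_integral_toReal_smul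
    (by unfold paretoPDF; fun_prop) (Eventually.of_forall fun x => by simp [paretoPDF])]
  -- The power `l ^ (1 + a)` prepares the substitution `y = l x`, whose Jacobian `l⁻¹` leaves `l ^
  -- a`.
  have h2 : ∀ x, (paretoPDF 1 a x).toReal • (1 - Real.exp (-(l * |x|)))
      = (Ici (1 : ℝ)).indicator
        (fun x => a * l ^ (1 + a) * levyIntegrand a (l * x)) x := by
    intro x
    by_cases hx : 1 ≤ x
    · have hx0 : 0 < x := lt_of_lt_of_le one_pos hx
      rw [indicator_of_mem (show x ∈ Ici 1 from hx), paretoPDF_of_le hx,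
        ENNReal.toReal_ofReal (by positivity), levyIntegrand, abs_of_pos hx0,
        Real.mul_rpow hl.le hx0.le, Real.one_rpow, smul_eq_mul,
        show -(1 + a) = -(a + 1) by ring, show (1 + a) = a + 1 by ring, Real.rpow_neg hl.le]
      have := (Real.rpow_pos_of_pos hl (a + 1)).ne'
      field_simp
    · rw [indicator_of_notMem (show x ∉ Ici 1 from hx), paretoPDF_of_lt (not_le.1 hx)]
      simp
  simp_rw [h2]
  rw [integral_indicator measurableSet_Ici, integral_Ici_eq_integral_Ioi, integral_const_mul,
    integral_comp_mul_left_Ioi _ _ hl, mul_one, smul_eq_mul, Real.rpow_add hl, Real.rpow_one]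
  field_simp

theorem tendsto_integral_Ioi_levyIntegrand {a : ℝ} (ha : 0 < a) (ha' : a < 1) {u : ℕ → ℝ}
    (hu : Tendsto u atTop (𝓝 0)) (hu' : ∀ n, 0 ≤ u n) :
    Tendsto (fun n => ∫ y in Ioi (u n), levyIntegrand a y) atTop
      (𝓝 (∫ y in Ioi (0 : ℝ), levyIntegrand a y)) := by
  have h := (aecover_Ioi_of_Ioi (μ := volume) hu).integral_tendsto_of_countably_generated
    (integrableOn_levyIntegrand ha ha')
  refine h.congr fun n => ?_
  rw [Measure.restrict_restrict measurableSet_Ioi,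
    inter_eq_left.2 (Ioi_subset_Ioi (hu' n))]

/-! ### Existence of the one-sided stable law. -/

/-- The law of the absolute sum of `n` independent Pareto variables, scaled by `c`. -/
def paretoSumLaw (a c : ℝ) (n : ℕ) : Measure ℝ :=
  (Measure.pi fun _ : Fin n => paretoMeasure 1 a).map (fun x => c * ∑ i, |x i|)

theorem isProbabilityMeasure_paretoSumLaw {a : ℝ} (ha : 0 < a) (c : ℝ) (n : ℕ) :
    IsProbabilityMeasure (paretoSumLaw a c n) := by
  have : IsProbabilityMeasure (paretoMeasure 1 a) := isProbabilityMeasure_paretoMeasure one_pos ha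
  exact Measure.isProbabilityMeasure_map (Measurable.aemeasurable (by fun_prop))

theorem laplace_paretoSumLaw {a : ℝ} (ha : 0 < a) {c : ℝ} (hc : 0 ≤ c) (n : ℕ) (l : ℝ) :
    ∫ y, Real.exp (-(l * |y|)) ∂(paretoSumLaw a c n)
      = (∫ x, Real.exp (-(l * c * |x|)) ∂(paretoMeasure 1 a)) ^ n := by
  have : IsProbabilityMeasure (paretoMeasure 1 a) := isProbabilityMeasure_paretoMeasure one_pos ha
  rw [paretoSumLaw, integral_map (Measurable.aemeasurable (by fun_prop))
    (Measurable.aestronglyMeasurable (by fun_prop))]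
  have h := integral_fintype_prod_eq_pow (𝕜 := ℝ) (ι := Fin n) (μ := paretoMeasure 1 a)
    (fun x => Real.exp (-(l * c * |x|)))
  rw [Fintype.card_fin] at h
  rw [← h]
  congr 1
  ext x
  rw [abs_of_nonneg (mul_nonneg hc (Finset.sum_nonneg fun i _ => abs_nonneg _)), ← Real.exp_sum,
    Finset.sum_neg_distrib, ← Finset.mul_sum, mul_assoc]

/-- Markov's inequality for `1 - exp (-|y| / k)`, which is at least `1 - exp (-1)` outside the
interval. It turns Laplace transform bounds near zero into tightness. -/
theorem measure_compl_Icc_le_of_laplace {μ : Measure ℝ} [IsProbabilityMeasure μ] {k δ : ℝ}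
    (hk : 0 < k) (h : 1 - ∫ y, Real.exp (-(k⁻¹ * |y|)) ∂μ ≤ δ) :
    μ.real (Icc (-k) k)ᶜ ≤ δ / (1 - Real.exp (-1)) := by
  have hint : Integrable (fun x => Real.exp (-(k⁻¹ * |x|))) μ := by
    refine Integrable.of_bound (by fun_prop) 1 (Eventually.of_forall fun x => ?_)
    rw [Real.norm_of_nonneg (Real.exp_pos _).le]
    exact Real.exp_le_one_iff.2 (by have := abs_nonneg x; have := inv_pos.2 hk; nlinarith)
  have hpos : 0 < 1 - Real.exp (-1) := by
    have : Real.exp (-1) < 1 := Real.exp_lt_one_iff.2 (by norm_num)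
    linarith
  rw [le_div_iff₀ hpos, mul_comm]
  have h1 : ∫ x, (1 - Real.exp (-(k⁻¹ * |x|))) ∂μ ≤ δ := by
    rw [integral_sub (integrable_const _) hint]
    simpa using h
  have h2 := mul_meas_ge_le_integral_of_nonneg (μ := μ) (f := fun x => 1 - Real.exp (-(k⁻¹ * |x|)))
    (Eventually.of_forall fun x => sub_nonneg.2
      (Real.exp_le_one_iff.2 (by have := abs_nonneg x; have := inv_pos.2 hk; nlinarith)))
    ((integrable_const _).sub hint) (1 - Real.exp (-1))
  refine le_trans ?_ (h2.trans h1)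
  refine mul_le_mul_of_nonneg_left (measureReal_mono ?_) hpos.le
  intro x hx
  have hx' : k ≤ |x| := by
    by_contra hlt
    exact hx (abs_le.1 (not_le.1 hlt).le)
  have : 1 ≤ k⁻¹ * |x| := by
    rw [inv_mul_eq_div, le_div_iff₀ hk]
    linarith
  have : Real.exp (-(k⁻¹ * |x|)) ≤ Real.exp (-1) := Real.exp_le_exp.2 (by linarith)
  simp only [mem_ofPred_eq]
  linarith

/-- Existence of the one-sided `a`-stable law, `0 < a < 1`, by its Laplace transform. -/
theorem exists_oneSidedStable {a : ℝ} (ha : 0 < a) (ha' : a < 1) :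
    ∃ μ : Measure ℝ, IsProbabilityMeasure μ ∧ (∀ᵐ s ∂μ, 0 < s) ∧
      ∀ l : ℝ, 0 < l → ∫ s, Real.exp (-(l * s)) ∂μ = Real.exp (-(l ^ a)) := by
  set J : ℝ := ∫ y in Ioi (0 : ℝ), levyIntegrand a y with hJ
  have hJ0 : 0 < J := integral_levyIntegrand_pos ha ha'
  -- Chosen so that `n * a * c n ^ a = J⁻¹`, which makes `n * (1 - φ (l * c n))` converge to `l ^
  -- a`.
  set c : ℕ → ℝ := fun n => ((n : ℝ) * (a * J)) ^ (-a⁻¹) with hc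
  have hc0 : ∀ n, 0 ≤ c n := fun n => Real.rpow_nonneg (by positivity) _
  have hca : ∀ n : ℕ, n ≠ 0 → 0 < c n ∧ (n : ℝ) * (a * c n ^ a) = J⁻¹ := by
    intro n hn
    have hn' : (0 : ℝ) < n := by positivity
    refine ⟨Real.rpow_pos_of_pos (by positivity) _, ?_⟩
    rw [hc]
    simp only
    rw [← Real.rpow_mul (by positivity), neg_mul, inv_mul_cancel₀ ha.ne', Real.rpow_neg_one]
    field_simp
  set φ : ℝ → ℝ := fun l => ∫ x, Real.exp (-(l * |x|)) ∂(paretoMeasure 1 a) with hφ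
  have hδ : ∀ l, 0 < l → ∀ n : ℕ, n ≠ 0 →
      (n : ℝ) * (1 - φ (l * c n)) = l ^ a * (J⁻¹ * ∫ y in Ioi (l * c n), levyIntegrand a y) := by
    intro l hl n hn
    obtain ⟨h1, h2⟩ := hca n hn
    rw [hφ, one_sub_laplace_pareto ha (mul_pos hl h1), Real.mul_rpow hl.le h1.le, ← h2]
    ring
  have hIle : ∀ t, 0 ≤ t → ∫ y in Ioi t, levyIntegrand a y ≤ J := fun t ht =>
    setIntegral_mono_set (integrableOn_levyIntegrand ha ha')
      ((ae_restrict_iff' measurableSet_Ioi).2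
        (Eventually.of_forall fun x hx => (levyIntegrand_pos a hx).le))
      (Ioi_subset_Ioi ht).eventuallyLE
  have hφ0 : ∀ l, 0 ≤ φ l := fun l => integral_nonneg fun x => (Real.exp_pos _).le
  -- Bernoulli's inequality: `1 - φ ^ n ≤ n * (1 - φ) ≤ l ^ a`. Uniformity in `n` is what gives
  -- tightness.
  have hbound : ∀ l, 0 < l → ∀ n : ℕ, 1 - φ (l * c n) ^ n ≤ l ^ a := by
    intro l hl n
    rcases eq_or_ne n 0 with rfl | hn
    · simpa using Real.rpow_nonneg hl.le a
    have h1 := one_add_mul_le_pow (a := -(1 - φ (l * c n)))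
      (by linarith [hφ0 (l * c n)]) n
    have h2 := hδ l hl n hn
    have h3 : J⁻¹ * ∫ y in Ioi (l * c n), levyIntegrand a y ≤ 1 := by
      rw [inv_mul_le_iff₀ hJ0, mul_one]
      exact hIle _ (mul_nonneg hl.le (hc0 n))
    have h4 := mul_le_mul_of_nonneg_left h3 (Real.rpow_nonneg hl.le a)
    have h5 : 1 + -(1 - φ (l * c n)) = φ (l * c n) := by ring
    rw [h5] at h1
    linarith
  have hc_tendsto : Tendsto c atTop (𝓝 0) := by
    have h1 : Tendsto (fun n : ℕ => (n : ℝ) * (a * J)) atTop atTop :=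
      tendsto_natCast_atTop_atTop.atTop_mul_const (by positivity)
    exact (tendsto_rpow_neg_atTop (inv_pos.2 ha)).comp h1
  have hlim : ∀ l, 0 < l → Tendsto (fun n => φ (l * c n) ^ n) atTop (𝓝 (Real.exp (-(l ^ a)))) := by
    intro l hl
    have h1 : Tendsto (fun n : ℕ => (n : ℝ) * (-(1 - φ (l * c n)))) atTop (𝓝 (-(l ^ a))) := by
      have h2 : Tendsto (fun n : ℕ => -(l ^ a * (J⁻¹ * ∫ y in Ioi (l * c n), levyIntegrand a y)))
          atTop (𝓝 (-(l ^ a * (J⁻¹ * J)))) := by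
        refine ((tendsto_integral_Ioi_levyIntegrand ha ha' ?_ fun n =>
          mul_nonneg hl.le (hc0 n)).const_mul _).const_mul _ |>.neg
        simpa using hc_tendsto.const_mul l
      rw [inv_mul_cancel₀ hJ0.ne', mul_one] at h2
      refine h2.congr' ?_
      filter_upwards [eventually_ne_atTop 0] with n hn
      rw [← hδ l hl n hn]
      ring
    refine (Real.tendsto_one_add_pow_exp_of_tendsto h1).congr fun n => ?_
    congr 1
    ring
  let M : ℕ → ProbabilityMeasure ℝ := fun n =>
    ⟨paretoSumLaw a (c n) n, isProbabilityMeasure_paretoSumLaw ha (c n) n⟩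
  have hM : ∀ n l, ∫ y, Real.exp (-(l * |y|)) ∂(M n : Measure ℝ) = φ (l * c n) ^ n := fun n l =>
    laplace_paretoSumLaw ha (hc0 n) n l
  -- The Markov tail bound on `[-(k+1), k+1]`, with `hbound` taken at `l = (k+1)⁻¹`.
  let u : ℕ → NNReal := fun k => Real.toNNReal ((((k : ℝ) + 1)⁻¹) ^ a / (1 - Real.exp (-1)))
  have hu : Tendsto u atTop (𝓝 0) := by
    have h1 : Tendsto (fun k : ℕ => ((((k : ℝ) + 1)⁻¹) ^ a / (1 - Real.exp (-1)))) atTop (𝓝 0) := by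
      have h2 : Tendsto (fun k : ℕ => (((k : ℝ) + 1)⁻¹)) atTop (𝓝 0) := by
        simpa using tendsto_one_div_add_atTop_nhds_zero_nat (𝕜 := ℝ)
      have h3 := (h2.rpow_const (p := a) (Or.inr ha.le)).div_const (1 - Real.exp (-1))
      simpa [Real.zero_rpow ha.ne'] using h3
    have h4 := (continuous_real_toNNReal.tendsto _).comp h1
    rw [Real.toNNReal_zero] at h4
    exact h4
  have hcomp := isCompact_setOfPred_probabilityMeasure_mass_eq_compl_isCompact_le (E := ℝ)
    (u := u) (K := fun k : ℕ => Icc (-((k : ℝ) + 1)) ((k : ℝ) + 1)) hu (fun k => isCompact_Icc)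
    (Or.inl inferInstance)
  have hmem : ∀ n, M n ∈ {μ : ProbabilityMeasure ℝ |
      ∀ k : ℕ, μ (Icc (-((k : ℝ) + 1)) ((k : ℝ) + 1))ᶜ ≤ u k} := by
    intro n k
    have hk : (0 : ℝ) < (k : ℝ) + 1 := by positivity
    have h1 := measure_compl_Icc_le_of_laplace (μ := (M n : Measure ℝ)) hk
      (δ := (((k : ℝ) + 1)⁻¹) ^ a) (by rw [hM]; exact hbound _ (inv_pos.2 hk) n)
    rw [← NNReal.coe_le_coe]
    exact h1.trans (Real.le_coe_toNNReal _)
  -- Prokhorov compactness. A limit along a nonprincipal ultrafilter replaces a convergent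
  -- subsequence; any limit point will do.
  obtain ⟨μ, -, hμ⟩ := hcomp.ultrafilter_le_nhds' ((hyperfilter ℕ).map M)
    (Ultrafilter.mem_map.2 (univ_mem' hmem))
  have hconv : Tendsto M (hyperfilter ℕ) (𝓝 μ) := hμ
  have hle : (hyperfilter ℕ : Filter ℕ) ≤ atTop := by
    rw [← Nat.cofinite_eq_atTop]
    exact hyperfilter_le_cofinite
  have hLap : ∀ l, 0 < l →
      ∫ y, Real.exp (-(l * |y|)) ∂(μ : Measure ℝ) = Real.exp (-(l ^ a)) := by
    intro l hl
    -- The absolute value keeps the test function bounded on the whole line, so that weak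
    -- convergence applies.
    let g : BoundedContinuousFunction ℝ ℝ := BoundedContinuousFunction.ofNormedAddCommGroup
      (fun y => Real.exp (-(l * |y|))) (by fun_prop) 1 (fun y => by
        rw [Real.norm_of_nonneg (Real.exp_pos _).le]
        exact Real.exp_le_one_iff.2 (by have := abs_nonneg y; nlinarith))
    have h1 := ProbabilityMeasure.tendsto_iff_forall_integral_tendsto.1 hconv g
    have h2 : Tendsto (fun n => ∫ y, g y ∂(M n : Measure ℝ)) (hyperfilter ℕ)
        (𝓝 (Real.exp (-(l ^ a)))) :=
      ((hlim l hl).mono_left hle).congr fun n => (hM n l).symm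
    exact tendsto_nhds_unique h1 h2
  -- Pushing forward by the absolute value gives nonnegativity at once, so only an atom at `0`
  -- remains to be excluded.
  refine ⟨(μ : Measure ℝ).map (fun y => |y|),
    Measure.isProbabilityMeasure_map (by fun_prop), ?_, fun l hl => ?_⟩
  · rw [ae_map_iff (by fun_prop) measurableSet_Ioi, ae_iff]
    have hset : {y : ℝ | ¬ 0 < |y|} = {0} := by
      ext y
      simp
    rw [hset, ← measureReal_eq_zero_iff]
    -- The mass at `0` is at most the Laplace transform at every `n + 1`, that is `exp (-(n+1) ^
    -- a)`, which tends to `0`.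
    refine le_antisymm (ge_of_tendsto' (x := atTop)
      (f := fun n : ℕ => Real.exp (-(((n : ℝ) + 1) ^ a))) ?_ ?_) measureReal_nonneg
    · refine Real.tendsto_exp_neg_atTop_nhds_zero.comp ((tendsto_rpow_atTop ha).comp ?_)
      exact tendsto_atTop_add_const_right _ _ tendsto_natCast_atTop_atTop
    · intro n
      have hn : (0 : ℝ) < (n : ℝ) + 1 := by positivity
      have hint : Integrable (fun x => Real.exp (-(((n : ℝ) + 1) * |x|))) (μ : Measure ℝ) := by
        refine Integrable.of_bound (by fun_prop) 1 (Eventually.of_forall fun x => ?_)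
        rw [Real.norm_of_nonneg (Real.exp_pos _).le]
        exact Real.exp_le_one_iff.2 (by have := abs_nonneg x; nlinarith)
      rw [← hLap _ hn]
      have h3 := mul_meas_ge_le_integral_of_nonneg
        (Eventually.of_forall fun x => (Real.exp_pos (-(((n : ℝ) + 1) * |x|))).le) hint 1
      rw [one_mul] at h3
      refine (measureReal_mono ?_).trans h3
      intro x hx
      rw [mem_singleton_iff] at hx
      simp [hx]
  · rw [integral_map (by fun_prop) (Measurable.aestronglyMeasurable (by fun_prop))]
    exact hLap l hl

/-! ### Moments of the one-sided stable law. -/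

theorem integrable_exp_neg_mul {μ : Measure ℝ} [IsProbabilityMeasure μ] (hpos : ∀ᵐ s ∂μ, 0 < s)
    {l : ℝ} (hl : 0 < l) : Integrable (fun s => Real.exp (-(l * s))) μ := by
  refine Integrable.of_bound (by fun_prop) 1 ?_
  filter_upwards [hpos] with s hs
  rw [Real.norm_of_nonneg (Real.exp_pos _).le]
  exact Real.exp_le_one_iff.2 (by have := mul_pos hl hs; linarith)

/-- Negative moments of the one-sided stable law. -/
theorem lintegral_rpow_neg_of_laplace {μ : Measure ℝ} [IsProbabilityMeasure μ]
    (hpos : ∀ᵐ s ∂μ, 0 < s) {a : ℝ} (ha : 0 < a)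
    (hLap : ∀ l : ℝ, 0 < l → ∫ s, Real.exp (-(l * s)) ∂μ = Real.exp (-(l ^ a)))
    {r : ℝ} (hr : 0 < r) :
    ∫⁻ s, ENNReal.ofReal (s ^ (-r)) ∂μ
      = ENNReal.ofReal (Real.Gamma (1 + r / a) / Real.Gamma (1 + r)) := by
  have hΓ := Real.Gamma_pos_of_pos hr
  -- Gamma integral for `s ^ (-r)`. Tonelli then replaces `exp (-(l * s))` by its mean `exp (-(l ^
  -- a))`, leaving another Gamma integral.
  have h1 : ∀ s : ℝ, 0 < s → ENNReal.ofReal (s ^ (-r)) = ENNReal.ofReal (Real.Gamma r)⁻¹ *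
      ∫⁻ l in Ioi (0 : ℝ), ENNReal.ofReal (l ^ (r - 1) * Real.exp (-(l * s))) := by
    intro s hs
    have hint : IntegrableOn (fun l : ℝ => l ^ (r - 1) * Real.exp (-(l * s))) (Ioi 0) := by
      have := integrableOn_rpow_mul_exp_neg_mul_rpow (s := r - 1) (p := 1) (b := s)
        (by linarith) one_pos hs
      refine this.congr_fun (fun l _ => ?_) measurableSet_Ioi
      simp only [Real.rpow_one, neg_mul, mul_comm s l]
    rw [← ofReal_integral_eq_lintegral_ofReal hint ((ae_restrict_iff' measurableSet_Ioi).2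
      (Eventually.of_forall fun l hl => mul_nonneg (Real.rpow_nonneg (le_of_lt hl) _)
        (Real.exp_pos _).le)), ← ENNReal.ofReal_mul (inv_nonneg.2 hΓ.le)]
    have h2 := Real.integral_rpow_mul_exp_neg_mul_Ioi hr hs
    simp_rw [mul_comm s] at h2
    rw [h2, Real.rpow_neg hs.le, Real.div_rpow zero_le_one hs.le, Real.one_rpow]
    congr 1
    field_simp
  have h3 : ∀ l ∈ Ioi (0 : ℝ), ∫⁻ s, ENNReal.ofReal (l ^ (r - 1) * Real.exp (-(l * s))) ∂μ
      = ENNReal.ofReal (l ^ (r - 1) * Real.exp (-(l ^ a))) := by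
    intro l hl
    rw [← ofReal_integral_eq_lintegral_ofReal ((integrable_exp_neg_mul hpos hl).const_mul _)
      (Eventually.of_forall fun s => mul_nonneg (Real.rpow_nonneg (le_of_lt hl) _)
        (Real.exp_pos _).le), integral_const_mul, hLap l hl]
  rw [lintegral_congr_ae (hpos.mono h1), lintegral_const_mul' _ _ ENNReal.ofReal_ne_top,
    lintegral_lintegral_swap (by fun_prop), setLIntegral_congr_fun measurableSet_Ioi h3]
  have hint : IntegrableOn (fun l : ℝ => l ^ (r - 1) * Real.exp (-(l ^ a))) (Ioi 0) :=
    integrableOn_rpow_mul_exp_neg_rpow (by linarith) ha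
  rw [← ofReal_integral_eq_lintegral_ofReal hint ((ae_restrict_iff' measurableSet_Ioi).2
      (Eventually.of_forall fun l hl => mul_nonneg (Real.rpow_nonneg (le_of_lt hl) _)
        (Real.exp_pos _).le)), ← ENNReal.ofReal_mul (inv_nonneg.2 hΓ.le),
    integral_rpow_mul_exp_neg_rpow ha (by linarith)]
  congr 1
  rw [add_comm 1 (r / a), add_comm 1 r, Real.Gamma_add_one (by positivity),
    Real.Gamma_add_one hr.ne', sub_add_cancel]
  field_simp

/-- Positive moments of the one-sided `a`-stable law of order less than `a` are finite. -/
theorem lintegral_rpow_lt_top_of_laplace {μ : Measure ℝ} [IsProbabilityMeasure μ]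
    (hpos : ∀ᵐ s ∂μ, 0 < s) {a : ℝ} (ha' : a < 1)
    (hLap : ∀ l : ℝ, 0 < l → ∫ s, Real.exp (-(l * s)) ∂μ = Real.exp (-(l ^ a)))
    {q : ℝ} (hq : 0 < q) (hqa : q < a) :
    ∫⁻ s, ENNReal.ofReal (s ^ q) ∂μ < ∞ := by
  have hJ := integral_levyIntegrand_pos hq (hqa.trans ha')
  set J := ∫ x in Ioi (0 : ℝ), levyIntegrand q x with hJdef
  -- The analogue for positive powers below one: subtracting `1` makes the integral over `l`
  -- converge at zero.
  have h1 : ∀ s : ℝ, 0 < s → ENNReal.ofReal (s ^ q) = ENNReal.ofReal J⁻¹ *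
      ∫⁻ l in Ioi (0 : ℝ), ENNReal.ofReal (l ^ (-(1 + q)) * (1 - Real.exp (-(l * s)))) := by
    intro s hs
    have heq : ∀ l ∈ Ioi (0 : ℝ), l ^ (-(1 + q)) * (1 - Real.exp (-(l * s)))
        = s ^ (1 + q) * levyIntegrand q (s * l) := by
      intro l hl
      rw [levyIntegrand, Real.mul_rpow hs.le (le_of_lt hl), Real.rpow_neg hs.le, mul_comm s l]
      have := (Real.rpow_pos_of_pos hs (1 + q)).ne'
      field_simp
    have hint : IntegrableOn (fun l => levyIntegrand q (s * l)) (Ioi 0) := by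
      have := (integrableOn_Ioi_comp_mul_left_iff (levyIntegrand q) 0 hs).2
      rw [mul_zero] at this
      exact this (integrableOn_levyIntegrand hq (hqa.trans ha'))
    rw [setLIntegral_congr_fun measurableSet_Ioi (fun l hl => by rw [heq l hl]),
      ← ofReal_integral_eq_lintegral_ofReal (hint.const_mul _)
        ((ae_restrict_iff' measurableSet_Ioi).2 (Eventually.of_forall fun l hl =>
          mul_nonneg (Real.rpow_nonneg hs.le _) (levyIntegrand_pos q (mul_pos hs hl)).le)),
      ← ENNReal.ofReal_mul (inv_nonneg.2 hJ.le), integral_const_mul,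
      integral_comp_mul_left_Ioi _ _ hs, mul_zero, ← hJdef, Real.rpow_add hs, Real.rpow_one,
      smul_eq_mul]
    congr 1
    field_simp
  have h3 : ∀ l ∈ Ioi (0 : ℝ),
      ∫⁻ s, ENNReal.ofReal (l ^ (-(1 + q)) * (1 - Real.exp (-(l * s)))) ∂μ
      = ENNReal.ofReal (l ^ (-(1 + q)) * (1 - Real.exp (-(l ^ a)))) := by
    intro l hl
    have hi := integrable_exp_neg_mul hpos hl
    have hi' : Integrable (fun s => l ^ (-(1 + q)) * (1 - Real.exp (-(l * s)))) μ :=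
      ((integrable_const _).sub hi).const_mul _
    rw [← ofReal_integral_eq_lintegral_ofReal hi' ?_,
      integral_const_mul, integral_sub (integrable_const _) hi, hLap l hl]
    · simp
    · filter_upwards [hpos] with s hs
      exact mul_nonneg (Real.rpow_nonneg (le_of_lt hl) _) (sub_nonneg.2
        (Real.exp_le_one_iff.2 (by have := mul_pos hl hs; linarith)))
  rw [lintegral_congr_ae (hpos.mono h1), lintegral_const_mul' _ _ ENNReal.ofReal_ne_top,
    lintegral_lintegral_swap (by fun_prop), setLIntegral_congr_fun measurableSet_Ioi h3]
  refine ENNReal.mul_lt_top ENNReal.ofReal_lt_top ?_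
  have hint : IntegrableOn (fun l : ℝ => l ^ (-(1 + q)) * (1 - Real.exp (-(l ^ a)))) (Ioi 0) := by
    have hm : Measurable (fun l : ℝ => l ^ (-(1 + q)) * (1 - Real.exp (-(l ^ a)))) := by fun_prop
    have hnn : ∀ l : ℝ, 0 < l → 0 ≤ l ^ (-(1 + q)) * (1 - Real.exp (-(l ^ a))) := fun l hl =>
      mul_nonneg (Real.rpow_nonneg hl.le _) (sub_nonneg.2
        (Real.exp_le_one_iff.2 (by have := Real.rpow_nonneg hl.le a; linarith)))
    rw [← Ioc_union_Ioi_eq_Ioi (zero_le_one (α := ℝ))]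
    refine IntegrableOn.union ?_ ?_
    -- Integrability at zero is where `q < a` enters, through `1 - exp (-(x ^ a)) ≤ x ^ a`.
    · have hb : IntegrableOn (fun x : ℝ => x ^ (a - 1 - q)) (Ioc 0 1) := by
        rw [integrableOn_Ioc_iff_integrableOn_Ioo]
        exact (intervalIntegral.integrableOn_Ioo_rpow_iff one_pos).2 (by linarith)
      refine Integrable.mono' hb hm.aestronglyMeasurable ?_
      refine (ae_restrict_iff' measurableSet_Ioc).2 (Eventually.of_forall fun x hx => ?_)
      rw [Real.norm_of_nonneg (hnn x hx.1)]
      have hle : 1 - Real.exp (-(x ^ a)) ≤ x ^ a := by linarith [Real.add_one_le_exp (-(x ^ a))]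
      refine (mul_le_mul_of_nonneg_left hle (Real.rpow_nonneg hx.1.le _)).trans_eq ?_
      rw [← Real.rpow_add hx.1]
      congr 1
      ring
    · have hb : IntegrableOn (fun x : ℝ => x ^ (-(1 + q))) (Ioi 1) :=
        integrableOn_Ioi_rpow_of_lt (by linarith) one_pos
      refine Integrable.mono' hb hm.aestronglyMeasurable ?_
      refine (ae_restrict_iff' measurableSet_Ioi).2 (Eventually.of_forall fun x hx => ?_)
      have hx0 : (0 : ℝ) < x := lt_trans one_pos hx
      rw [Real.norm_of_nonneg (hnn x hx0)]
      exact mul_le_of_le_one_right (Real.rpow_nonneg hx0.le _)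
        (by linarith [Real.exp_pos (-(x ^ a))])
  exact hint.lintegral_lt_top

/-! ### Standard Gaussian vectors -/

/-- The density of the standard Gaussian law on `ℝ^d`. -/
def gaussianDensity {d : ℕ} (z : EuclideanSpace ℝ (Fin d)) : ℝ :=
  (2 * Real.pi) ^ (-(d : ℝ) / 2) * Real.exp (-(1 / 2) * ‖z‖ ^ 2)

theorem gaussianDensity_pos {d : ℕ} (z : EuclideanSpace ℝ (Fin d)) : 0 < gaussianDensity z := by
  unfold gaussianDensity
  positivity

theorem continuous_gaussianDensity {d : ℕ} :
    Continuous (gaussianDensity : EuclideanSpace ℝ (Fin d) → ℝ) := by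
  unfold gaussianDensity
  fun_prop

theorem integrable_gaussianDensity {d : ℕ} :
    Integrable (gaussianDensity : EuclideanSpace ℝ (Fin d) → ℝ) := by
  refine Integrable.const_mul (Integrable.of_integral_ne_zero ?_) _
  rw [GaussianFourier.integral_rexp_neg_mul_sq_norm (by norm_num)]
  positivity

theorem stdGaussian_eq_withDensity (d : ℕ) :
    stdGaussian (EuclideanSpace ℝ (Fin d))
      = volume.withDensity (fun z => ENNReal.ofReal (gaussianDensity z)) := by
  have hfin : IsFiniteMeasure ((volume : Measure (EuclideanSpace ℝ (Fin d))).withDensity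
      (fun z => ENNReal.ofReal (gaussianDensity z))) :=
    isFiniteMeasure_withDensity_ofReal integrable_gaussianDensity.2
  refine Measure.ext_of_charFun (funext fun t => ?_)
  rw [charFun_stdGaussian, charFun_apply, integral_withDensity_eq_integral_toReal_smul
    (by exact (continuous_gaussianDensity.measurable.ennreal_ofReal))
    (Eventually.of_forall fun x => ENNReal.ofReal_lt_top)]
  have h : ∀ x : EuclideanSpace ℝ (Fin d),
      (ENNReal.ofReal (gaussianDensity x)).toReal • Complex.exp (inner ℝ x t * Complex.I)
      = (((2 * Real.pi) ^ (-(d : ℝ) / 2) : ℝ) : ℂ)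
        * Complex.exp (-(1 / 2 : ℂ) * ‖x‖ ^ 2 + Complex.I * inner ℝ t x) := by
    intro x
    rw [ENNReal.toReal_ofReal (gaussianDensity_pos x).le, gaussianDensity, Complex.real_smul,
      Complex.ofReal_mul, mul_assoc, Complex.ofReal_exp, ← Complex.exp_add, real_inner_comm]
    push_cast
    ring_nf
  simp_rw [h]
  rw [integral_const_mul, GaussianFourier.integral_cexp_neg_mul_sq_norm_add (by norm_num)]
  have h2 : ((Real.pi : ℂ) / (1 / 2)) ^ ((Module.finrank ℝ (EuclideanSpace ℝ (Fin d)) : ℂ) / 2)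
      = (((2 * Real.pi) ^ ((d : ℝ) / 2) : ℝ) : ℂ) := by
    rw [Complex.ofReal_cpow (by positivity)]
    simp [mul_comm]
  rw [h2, ← mul_assoc, ← Complex.ofReal_mul, ← Real.rpow_add (by positivity)]
  rw [show -(d : ℝ) / 2 + d / 2 = 0 by ring, Real.rpow_zero, Complex.ofReal_one, one_mul,
    Complex.I_sq]
  congr 1
  ring

theorem lintegral_stdGaussian {d : ℕ} {g : EuclideanSpace ℝ (Fin d) → ℝ≥0∞} (hg : Measurable g) :
    ∫⁻ z, g z ∂(stdGaussian (EuclideanSpace ℝ (Fin d)))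
      = ∫⁻ z, ENNReal.ofReal (gaussianDensity z) * g z := by
  rw [stdGaussian_eq_withDensity,
    lintegral_withDensity_eq_lintegral_mul _
      continuous_gaussianDensity.measurable.ennreal_ofReal hg]
  rfl

theorem integral_stdGaussian {d : ℕ} (g : EuclideanSpace ℝ (Fin d) → ℝ) :
    ∫ z, g z ∂(stdGaussian (EuclideanSpace ℝ (Fin d))) = ∫ z, gaussianDensity z * g z := by
  rw [stdGaussian_eq_withDensity, integral_withDensity_eq_integral_toReal_smul
    continuous_gaussianDensity.measurable.ennreal_ofReal
    (Eventually.of_forall fun x => ENNReal.ofReal_lt_top)]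
  simp_rw [ENNReal.toReal_ofReal (gaussianDensity_pos _).le, smul_eq_mul]

theorem integrable_stdGaussian_iff {d : ℕ} (g : EuclideanSpace ℝ (Fin d) → ℝ) :
    Integrable g (stdGaussian (EuclideanSpace ℝ (Fin d)))
      ↔ Integrable (fun z => gaussianDensity z * g z) := by
  rw [stdGaussian_eq_withDensity, integrable_withDensity_iff_integrable_smul'
    continuous_gaussianDensity.measurable.ennreal_ofReal
    (Eventually.of_forall fun x => ENNReal.ofReal_lt_top)]
  simp_rw [ENNReal.toReal_ofReal (gaussianDensity_pos _).le, smul_eq_mul]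

theorem lintegral_inner_sq_stdGaussian {d : ℕ} (h : EuclideanSpace ℝ (Fin d)) :
    ∫⁻ z, ENNReal.ofReal |inner ℝ h z| ^ (2 : ℝ) ∂(stdGaussian (EuclideanSpace ℝ (Fin d)))
      = ENNReal.ofReal (‖h‖ ^ 2) := by
  have h1 := variance_dual_stdGaussian (innerSL ℝ h)
  rw [innerSL_apply_norm, variance_of_integral_eq_zero (by fun_prop)
    (integral_strongDual_stdGaussian _)] at h1
  have hL : MemLp (innerSL ℝ h) 2 (stdGaussian (EuclideanSpace ℝ (Fin d))) :=
    IsGaussian.memLp_dual _ _ _ (by simp)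
  rw [← h1, ofReal_integral_eq_lintegral_ofReal hL.integrable_sq
    (Eventually.of_forall fun z => sq_nonneg _)]
  refine lintegral_congr fun z => ?_
  rw [ENNReal.ofReal_rpow_of_nonneg (abs_nonneg _) (by norm_num)]
  simp

/-- Moments of the norm of a standard Gaussian vector. -/
theorem lintegral_norm_rpow_stdGaussian {d : ℕ} (hd : 0 < d) {p : ℝ} (hp : 0 < p) :
    ∫⁻ z, ENNReal.ofReal (‖z‖ ^ p) ^ (2 : ℝ) ∂(stdGaussian (EuclideanSpace ℝ (Fin d)))
      = ENNReal.ofReal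
        ((2 : ℝ) ^ p * (Real.Gamma (p + (d : ℝ) / 2) / Real.Gamma ((d : ℝ) / 2))) := by
  have : Nonempty (Fin d) := ⟨⟨0, hd⟩⟩
  have hd' : (0 : ℝ) < d := by exact_mod_cast hd
  -- Radial profile for polar coordinates. The exponent is `2 * p` because `‖z‖ ^ p` is squared for
  -- Cauchy–Schwarz.
  set f : ℝ → ℝ := fun y => (2 * Real.pi) ^ (-(d : ℝ) / 2) * Real.exp (-(1 / 2) * y ^ 2)
    * y ^ (2 * p) with hf
  have h0 : ∫ y in Ioi (0 : ℝ), y ^ (d - 1) • f y = (2 * Real.pi) ^ (-(d : ℝ) / 2) *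
      ((1 / 2) ^ (-(d + 2 * p) / 2) * (1 / 2) * Real.Gamma ((d + 2 * p) / 2)) := by
    have h1 := integral_rpow_mul_exp_neg_mul_rpow (p := 2) (q := d - 1 + 2 * p) (b := 1 / 2)
      (by norm_num) (by linarith) (by norm_num)
    rw [show (d : ℝ) - 1 + 2 * p + 1 = d + 2 * p by ring] at h1
    rw [← h1, ← integral_const_mul]
    refine setIntegral_congr_fun measurableSet_Ioi fun y hy => ?_
    have hy' : (0 : ℝ) < y := hy
    simp only [hf, smul_eq_mul]
    rw [Real.rpow_add hy', ← Real.rpow_natCast y (d - 1), Nat.cast_sub (by omega), Nat.cast_one,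
      Real.rpow_two]
    ring
  have hval : ∫ z : EuclideanSpace ℝ (Fin d), f ‖z‖
      = (2 : ℝ) ^ p * (Real.Gamma (p + (d : ℝ) / 2) / Real.Gamma ((d : ℝ) / 2)) := by
    rw [integral_fun_norm_addHaar volume f, finrank_euclideanSpace, Fintype.card_fin, h0,
      Measure.real, EuclideanSpace.volume_ball]
    rw [Fintype.card_fin, ENNReal.ofReal_one, one_pow, one_mul,
      ENNReal.toReal_ofReal (by positivity), Real.Gamma_add_one (by positivity),
      show ((d : ℝ) + 2 * p) / 2 = p + d / 2 by ring, nsmul_eq_mul, smul_eq_mul,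
      Real.mul_rpow (by norm_num) Real.pi_pos.le, Real.sqrt_eq_rpow, ← Real.rpow_natCast,
      ← Real.rpow_mul Real.pi_pos.le, one_div, Real.inv_rpow (by norm_num), ← Real.rpow_neg
      (by norm_num), show -(-((d : ℝ) + 2 * p) / 2) = d / 2 + p by ring,
      Real.rpow_add (by norm_num), show -(d : ℝ) / 2 = -(d / 2) by ring,
      Real.rpow_neg (by norm_num), Real.rpow_neg Real.pi_pos.le, show (2 : ℝ)⁻¹ * d = d / 2 by ring]
    have h2 := (Real.Gamma_pos_of_pos (show 0 < (d : ℝ) / 2 by positivity)).ne'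
    field_simp
  have hpos : 0 < (2 : ℝ) ^ p * (Real.Gamma (p + (d : ℝ) / 2) / Real.Gamma ((d : ℝ) / 2)) := by
    have := Real.Gamma_pos_of_pos (show 0 < (d : ℝ) / 2 by positivity)
    have := Real.Gamma_pos_of_pos (show 0 < p + (d : ℝ) / 2 by positivity)
    positivity
  rw [lintegral_stdGaussian (by fun_prop), ← hval, ofReal_integral_eq_lintegral_ofReal
    (Integrable.of_integral_ne_zero (by rw [hval]; exact hpos.ne'))
    (Eventually.of_forall fun z => by simp only [hf]; positivity)]
  refine lintegral_congr fun z => ?_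
  rw [ENNReal.ofReal_rpow_of_nonneg (by positivity) (by norm_num), ← Real.rpow_mul (norm_nonneg _),
    ← ENNReal.ofReal_mul (gaussianDensity_pos z).le, mul_comm p 2]
  rfl

/-! ### Translating a Gaussian law. -/

/-- The fundamental theorem of calculus along the shift. The factor linear in `h` makes the cost of
a shift linear in `‖h‖`. -/
theorem gaussianDensity_sub_eq_integral {d : ℕ} (h z : EuclideanSpace ℝ (Fin d)) :
    gaussianDensity (z - h) - gaussianDensity z
      = ∫ r in (0 : ℝ)..1, inner ℝ h (z - r • h) * gaussianDensity (z - r • h) := by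
  have hderiv : ∀ r : ℝ, HasDerivAt (fun r : ℝ => gaussianDensity (z - r • h))
      (inner ℝ h (z - r • h) * gaussianDensity (z - r • h)) r := by
    intro r
    have h1 : HasDerivAt (fun r : ℝ => z - r • h) (-h) r := by
      simpa using ((hasDerivAt_id r).smul_const h).const_sub z
    have h2 := ((h1.norm_sq.const_mul (-(1 / 2) : ℝ)).exp).const_mul
      ((2 * Real.pi) ^ (-(d : ℝ) / 2))
    refine h2.congr_deriv ?_
    rw [gaussianDensity, inner_neg_right, real_inner_comm]
    ring
  have hc : Continuous fun r : ℝ => inner ℝ h (z - r • h) * gaussianDensity (z - r • h) := by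
    have := continuous_gaussianDensity (d := d)
    fun_prop
  rw [intervalIntegral.integral_eq_sub_of_hasDerivAt (fun r _ => hderiv r)
    (hc.intervalIntegrable _ _)]
  simp

theorem enorm_gaussianDensity_sub_le {d : ℕ} (h z : EuclideanSpace ℝ (Fin d)) :
    ‖gaussianDensity (z - h) - gaussianDensity z‖ₑ
      ≤ ∫⁻ r in Ioc (0 : ℝ) 1, ENNReal.ofReal |inner ℝ h (z - r • h)|
          * ENNReal.ofReal (gaussianDensity (z - r • h)) := by
  rw [gaussianDensity_sub_eq_integral, intervalIntegral.integral_of_le zero_le_one]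
  refine (enorm_integral_le_lintegral_enorm _).trans_eq (lintegral_congr fun r => ?_)
  rw [enorm_mul, Real.enorm_eq_ofReal_abs, Real.enorm_of_nonneg (gaussianDensity_pos _).le]

/-- Smoothing by a Gaussian: the effect of a shift on the expectation of `G`, when `|G| ≤ W`. -/
theorem enorm_integral_shift_stdGaussian_le {d : ℕ} {G : EuclideanSpace ℝ (Fin d) → ℝ}
    {W : EuclideanSpace ℝ (Fin d) → ℝ≥0∞} (hW : Measurable W)
    (hGW : ∀ z, ‖G z‖ₑ ≤ W z) (h : EuclideanSpace ℝ (Fin d))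
    (h0 : Integrable G (stdGaussian (EuclideanSpace ℝ (Fin d))))
    (h1 : Integrable (fun z => G (z + h)) (stdGaussian (EuclideanSpace ℝ (Fin d)))) :
    ‖∫ z, G (z + h) ∂(stdGaussian (EuclideanSpace ℝ (Fin d)))
        - ∫ z, G z ∂(stdGaussian (EuclideanSpace ℝ (Fin d)))‖ₑ
      ≤ ∫⁻ r in Ioc (0 : ℝ) 1, ∫⁻ z, W (z + r • h) * ENNReal.ofReal |inner ℝ h z|
          ∂(stdGaussian (EuclideanSpace ℝ (Fin d))) := by
  -- The shift moves from `G`, which has no regularity, to the smooth density.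
  have hshift : ∫ z, gaussianDensity z * G (z + h) = ∫ z, gaussianDensity (z - h) * G z := by
    rw [← integral_add_right_eq_self (fun z => gaussianDensity (z - h) * G z) h]
    simp
  rw [integrable_stdGaussian_iff] at h0 h1
  have h1' : Integrable (fun z => gaussianDensity (z - h) * G z) := by
    have := h1.comp_sub_right h
    simpa using this
  rw [integral_stdGaussian, integral_stdGaussian, hshift, ← integral_sub h1' h0]
  have hm : Measurable (Function.uncurry fun (z : EuclideanSpace ℝ (Fin d)) (r : ℝ) =>
      W z * (ENNReal.ofReal |inner ℝ h (z - r • h)|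
          * ENNReal.ofReal (gaussianDensity (z - r • h)))) := by
    have := (continuous_gaussianDensity (d := d)).measurable
    fun_prop
  calc ‖∫ z, (gaussianDensity (z - h) * G z - gaussianDensity z * G z)‖ₑ
      ≤ ∫⁻ z, ‖gaussianDensity (z - h) * G z - gaussianDensity z * G z‖ₑ :=
        enorm_integral_le_lintegral_enorm _
    _ ≤ ∫⁻ z, ∫⁻ r in Ioc (0 : ℝ) 1, W z * (ENNReal.ofReal |inner ℝ h (z - r • h)|
          * ENNReal.ofReal (gaussianDensity (z - r • h))) := by
        refine lintegral_mono fun z => ?_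
        have hmz : Measurable fun r : ℝ => ENNReal.ofReal |inner ℝ h (z - r • h)|
          * ENNReal.ofReal (gaussianDensity (z - r • h)) := by
          have := (continuous_gaussianDensity (d := d)).measurable
          fun_prop
        rw [lintegral_const_mul _ hmz, ← sub_mul, enorm_mul, mul_comm]
        exact mul_le_mul' (hGW z) (enorm_gaussianDensity_sub_le h z)
    _ = ∫⁻ r in Ioc (0 : ℝ) 1, ∫⁻ z, W z * (ENNReal.ofReal |inner ℝ h (z - r • h)|
          * ENNReal.ofReal (gaussianDensity (z - r • h))) :=
        lintegral_lintegral_swap hm.aemeasurable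
    _ = _ := by
        refine lintegral_congr fun r => ?_
        -- Translating back by `r • h` restores the centred density and puts the shift on the
        -- weight.
        rw [lintegral_stdGaussian (by fun_prop),
          ← lintegral_add_right_eq_self _ (r • h)]
        refine lintegral_congr fun z => ?_
        rw [add_sub_cancel_right]
        ring

/-- Cauchy–Schwarz bound for weights growing at most like `A + T ‖z‖ ^ p`. -/
theorem lintegral_weight_mul_inner_le {d : ℕ} (hd : 0 < d) {p : ℝ} (hp : 0 < p) (A T : ℝ≥0∞)
    (h : EuclideanSpace ℝ (Fin d)) :
    ∫⁻ z, (A + T * ENNReal.ofReal (‖z‖ ^ p)) * ENNReal.ofReal |inner ℝ h z|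
        ∂(stdGaussian (EuclideanSpace ℝ (Fin d)))
      ≤ ENNReal.ofReal ‖h‖ * (A + T * ENNReal.ofReal
        √((2 : ℝ) ^ p * (Real.Gamma (p + (d : ℝ) / 2) / Real.Gamma ((d : ℝ) / 2)))) := by
  set γ := stdGaussian (EuclideanSpace ℝ (Fin d))
  have hpos : 0 ≤ (2 : ℝ) ^ p * (Real.Gamma (p + (d : ℝ) / 2) / Real.Gamma ((d : ℝ) / 2)) := by
    have hd' : (0 : ℝ) < d := by exact_mod_cast hd
    have := Real.Gamma_pos_of_pos (show 0 < (d : ℝ) / 2 by positivity)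
    have := Real.Gamma_pos_of_pos (show 0 < p + (d : ℝ) / 2 by positivity)
    positivity
  have hh : (∫⁻ z, ENNReal.ofReal |inner ℝ h z| ^ (2 : ℝ) ∂γ) ^ (1 / 2 : ℝ)
      = ENNReal.ofReal ‖h‖ := by
    rw [lintegral_inner_sq_stdGaussian, ENNReal.ofReal_rpow_of_nonneg (by positivity) (by norm_num),
      ← Real.sqrt_eq_rpow, Real.sqrt_sq (norm_nonneg _)]
  have h1 : ∫⁻ z, ENNReal.ofReal |inner ℝ h z| ∂γ ≤ ENNReal.ofReal ‖h‖ := by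
    have := ENNReal.lintegral_mul_le_Lp_mul_Lq γ Real.HolderConjugate.two_two
      (f := fun _ => 1) (g := fun z => ENNReal.ofReal |inner ℝ h z|) (by fun_prop) (by fun_prop)
    rw [hh] at this
    simpa [γ] using this
  have h2 : ∫⁻ z, ENNReal.ofReal (‖z‖ ^ p) * ENNReal.ofReal |inner ℝ h z| ∂γ
      ≤ ENNReal.ofReal √((2 : ℝ) ^ p * (Real.Gamma (p + (d : ℝ) / 2) / Real.Gamma ((d : ℝ) / 2)))
        * ENNReal.ofReal ‖h‖ := by
    have := ENNReal.lintegral_mul_le_Lp_mul_Lq γ Real.HolderConjugate.two_two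
      (f := fun z => ENNReal.ofReal (‖z‖ ^ p)) (g := fun z => ENNReal.ofReal |inner ℝ h z|)
      (by fun_prop) (by fun_prop)
    rw [hh, lintegral_norm_rpow_stdGaussian hd hp, ENNReal.ofReal_rpow_of_nonneg hpos (by norm_num),
      ← Real.sqrt_eq_rpow] at this
    exact this
  calc _ = A * ∫⁻ z, ENNReal.ofReal |inner ℝ h z| ∂γ
        + T * ∫⁻ z, ENNReal.ofReal (‖z‖ ^ p) * ENNReal.ofReal |inner ℝ h z| ∂γ := by
        rw [← lintegral_const_mul _ (by fun_prop), ← lintegral_const_mul _ (by fun_prop),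
          ← lintegral_add_left (by fun_prop)]
        refine lintegral_congr fun z => ?_
        ring
    _ ≤ A * ENNReal.ofReal ‖h‖ + T * (_ * ENNReal.ofReal ‖h‖) := by gcongr
    _ = _ := by ring

/-! ### Subordination of rotationally invariant stable laws -/

/-- A rotationally invariant stable vector is `√(2S) Z` with `S` one-sided stable and `Z` an
independent standard Gaussian vector. -/
theorem IsRotInvStable.eq_map_prod {d : ℕ} {α : ℝ} (hα : 0 < α)
    {ν : Measure (EuclideanSpace ℝ (Fin d))} [IsProbabilityMeasure ν] (hν : IsRotInvStable α ν)
    {μ : Measure ℝ} [IsProbabilityMeasure μ] (hpos : ∀ᵐ s ∂μ, 0 < s)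
    (hLap : ∀ l : ℝ, 0 < l → ∫ s, Real.exp (-(l * s)) ∂μ = Real.exp (-(l ^ (α / 2)))) :
    ν = (μ.prod (stdGaussian (EuclideanSpace ℝ (Fin d)))).map (fun q => √(2 * q.1) • q.2) := by
  have hmeas : Measurable (fun q : ℝ × EuclideanSpace ℝ (Fin d) => √(2 * q.1) • q.2) := by
    fun_prop
  have := Measure.isProbabilityMeasure_map
    (μ := μ.prod (stdGaussian (EuclideanSpace ℝ (Fin d)))) hmeas.aemeasurable
  refine Measure.ext_of_charFun (funext fun t => ?_)
  rw [hν t, charFun_apply, integral_map hmeas.aemeasurable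
    (Measurable.aestronglyMeasurable (by fun_prop)), integral_prod]
  -- Given `S = s` the covariance is `2 s`, so the characteristic function is `exp (-(s ‖t‖²))`.
  -- Averaging gives the Laplace transform at `‖t‖²`, and `(‖t‖²) ^ (α/2) = ‖t‖ ^ α`.
  · have h1 : ∀ᵐ s ∂μ, ∫ z, Complex.exp (inner ℝ (√(2 * s) • z) t * Complex.I)
        ∂(stdGaussian (EuclideanSpace ℝ (Fin d))) = ((Real.exp (-(‖t‖ ^ 2 * s)) : ℝ) : ℂ) := by
      filter_upwards [hpos] with s hs
      have h2 := charFun_stdGaussian (√(2 * s) • t)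
      rw [charFun_apply] at h2
      simp_rw [real_inner_smul_left]
      simp_rw [real_inner_smul_right] at h2
      rw [h2, norm_smul, Real.norm_of_nonneg (Real.sqrt_nonneg _)]
      push_cast
      congr 1
      rw [mul_pow, ← Complex.ofReal_pow, Real.sq_sqrt (by positivity)]
      push_cast
      ring
    rw [integral_congr_ae h1, integral_complex_ofReal]
    congr 1
    rcases eq_or_ne t 0 with rfl | ht
    · simp [Real.zero_rpow hα.ne']
    · rw [hLap _ (by positivity), ← Real.rpow_natCast, ← Real.rpow_mul (norm_nonneg _)]
      congr 3
      push_cast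
      ring
  · refine Integrable.of_bound (Measurable.aestronglyMeasurable (by fun_prop)) 1
      (Eventually.of_forall fun q => ?_)
    rw [Complex.norm_exp_ofReal_mul_I]

theorem lintegral_norm_rpow_stdGaussian_lt_top {d : ℕ} (hd : 0 < d) {p : ℝ} (hp : 0 < p) :
    ∫⁻ z, ENNReal.ofReal (‖z‖ ^ p) ∂(stdGaussian (EuclideanSpace ℝ (Fin d))) < ∞ := by
  have h := lintegral_norm_rpow_stdGaussian hd (half_pos hp)
  have h2 : ∀ z : EuclideanSpace ℝ (Fin d),
      ENNReal.ofReal (‖z‖ ^ (p / 2)) ^ (2 : ℝ) = ENNReal.ofReal (‖z‖ ^ p) := by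
    intro z
    rw [ENNReal.ofReal_rpow_of_nonneg (by positivity) (by norm_num),
      ← Real.rpow_mul (norm_nonneg _)]
    congr 2
    ring
  simp_rw [h2] at h
  rw [h]
  exact ENNReal.ofReal_lt_top

/-- Moments of order `p < α` of a rotationally invariant `α`-stable vector are finite. -/
theorem IsRotInvStable.lintegral_norm_rpow_lt_top {d : ℕ} (hd : 0 < d) {α p : ℝ} (hp : 0 < p)
    (hpα : p < α) (hα : α < 2) {ν : Measure (EuclideanSpace ℝ (Fin d))} [IsProbabilityMeasure ν]
    (hν : IsRotInvStable α ν) :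
    ∫⁻ z, ENNReal.ofReal (‖z‖ ^ p) ∂ν < ∞ := by
  obtain ⟨μ, hμ, hpos, hLap⟩ := exists_oneSidedStable (a := α / 2) (by linarith) (by linarith)
  rw [hν.eq_map_prod (hp.trans hpα) hpos hLap, lintegral_map (by fun_prop) (by fun_prop),
    lintegral_prod _ (by fun_prop)]
  -- The moment factors into a Gaussian one and the moment of `S` of order `p / 2 < α / 2`.
  have h1 : ∀ᵐ s ∂μ, ∫⁻ z, ENNReal.ofReal (‖√(2 * s) • z‖ ^ p)
      ∂(stdGaussian (EuclideanSpace ℝ (Fin d)))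
      = ENNReal.ofReal (2 ^ (p / 2)) * ENNReal.ofReal (s ^ (p / 2)) *
        ∫⁻ z, ENNReal.ofReal (‖z‖ ^ p) ∂(stdGaussian (EuclideanSpace ℝ (Fin d))) := by
    filter_upwards [hpos] with s hs
    rw [← lintegral_const_mul _ (by fun_prop)]
    refine lintegral_congr fun z => ?_
    rw [norm_smul, Real.norm_of_nonneg (Real.sqrt_nonneg _),
      Real.mul_rpow (Real.sqrt_nonneg _) (norm_nonneg _), Real.sqrt_eq_rpow,
      ← Real.rpow_mul (by positivity), ← ENNReal.ofReal_mul (by positivity),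
      ← ENNReal.ofReal_mul (by positivity), ← Real.mul_rpow (by norm_num) hs.le]
    congr 3
    ring
  rw [lintegral_congr_ae h1, lintegral_mul_const _ (by fun_prop),
    lintegral_const_mul _ (by fun_prop)]
  exact ENNReal.mul_lt_top (ENNReal.mul_lt_top ENNReal.ofReal_lt_top
    (lintegral_rpow_lt_top_of_laplace hpos (by linarith) hLap (by linarith) (by linarith)))
    (lintegral_norm_rpow_stdGaussian_lt_top hd hp)

/-! ### The Lyapunov function -/

theorem lyapunov_pos {d : ℕ} (ϑ : EuclideanSpace ℝ (Fin d)) (p : ℝ)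
    (θ : EuclideanSpace ℝ (Fin d)) : 0 < lyapunov ϑ p θ := by
  unfold lyapunov
  positivity

theorem measurable_lyapunov {d : ℕ} (ϑ : EuclideanSpace ℝ (Fin d)) (p : ℝ) :
    Measurable (lyapunov ϑ p) := by
  unfold lyapunov
  fun_prop

theorem sqrt_one_add_norm_sq_add_le {E : Type*} [SeminormedAddCommGroup E] (x y : E) :
    √(1 + ‖x + y‖ ^ 2) ≤ √(1 + ‖x‖ ^ 2) + ‖y‖ := by
  have hx := norm_nonneg x
  have hy := norm_nonneg y
  have hs : ‖x‖ ≤ √(1 + ‖x‖ ^ 2) := Real.le_sqrt_of_sq_le (by linarith)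
  rw [Real.sqrt_le_left (by positivity)]
  have h1 : ‖x + y‖ ^ 2 ≤ (‖x‖ + ‖y‖) ^ 2 := by
    gcongr
    exact norm_add_le x y
  have h2 : √(1 + ‖x‖ ^ 2) ^ 2 = 1 + ‖x‖ ^ 2 := Real.sq_sqrt (by positivity)
  nlinarith

/-- `x ↦ √(1 + ‖x‖²)` is 1-Lipschitz and `x ↦ x ^ p` is subadditive for `p ≤ 1`. This separates the
centre from the noise. -/
theorem lyapunov_add_le {d : ℕ} (ϑ : EuclideanSpace ℝ (Fin d)) {p : ℝ} (hp : 0 < p) (hp' : p ≤ 1)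
    (u y : EuclideanSpace ℝ (Fin d)) :
    lyapunov ϑ p (u + y) ≤ lyapunov ϑ p u + ‖y‖ ^ p := by
  have h : ∀ x : EuclideanSpace ℝ (Fin d), lyapunov ϑ p x = √(1 + ‖x - ϑ‖ ^ 2) ^ p := by
    intro x
    rw [lyapunov, Real.sqrt_eq_rpow, ← Real.rpow_mul (by positivity)]
    congr 1
    ring
  rw [h, h, show u + y - ϑ = (u - ϑ) + y by abel]
  refine (Real.rpow_le_rpow (Real.sqrt_nonneg _) (sqrt_one_add_norm_sq_add_le _ _) hp.le).trans ?_
  exact Real.rpow_add_le_add_rpow (Real.sqrt_nonneg _) (norm_nonneg _) hp.le hp'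

theorem integrable_lyapunov_affine {d : ℕ} (hd : 0 < d) {α p σ : ℝ} (hp : 0 < p) (hp' : p ≤ 1)
    (hpα : p < α) (hα : α < 2) (hσ : 0 < σ) {ν : Measure (EuclideanSpace ℝ (Fin d))}
    [IsProbabilityMeasure ν] (hν : IsRotInvStable α ν) (ϑ c : EuclideanSpace ℝ (Fin d)) :
    Integrable (fun z => lyapunov ϑ p (c + σ • z)) ν := by
  have hmom : Integrable (fun z : EuclideanSpace ℝ (Fin d) => ‖z‖ ^ p) ν := by
    refine ⟨Measurable.aestronglyMeasurable (by fun_prop), ?_⟩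
    rw [hasFiniteIntegral_iff_ofReal (Eventually.of_forall fun z => by positivity)]
    exact hν.lintegral_norm_rpow_lt_top hd hp hpα hα
  refine Integrable.mono' ((integrable_const (lyapunov ϑ p c)).add (hmom.const_mul (σ ^ p)))
    ((measurable_lyapunov ϑ p).comp (by fun_prop)).aestronglyMeasurable
    (Eventually.of_forall fun z => ?_)
  rw [Real.norm_of_nonneg (lyapunov_pos _ _ _).le]
  refine (lyapunov_add_le ϑ hp hp' c (σ • z)).trans_eq ?_
  rw [norm_smul, Real.norm_of_nonneg hσ.le, Real.mul_rpow hσ.le (norm_nonneg _)]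
  rfl

/-! ### Shifted stable laws in weighted total variation -/

/-- The effect of moving the center of a Gaussian law with covariance `t²` along a segment on which
the Lyapunov function is at most `A`. -/
theorem enorm_integral_gaussian_sub_le {d : ℕ} (hd : 0 < d) {p t A : ℝ} (hp : 0 < p) (hp' : p ≤ 1)
    (ht : 0 < t) {ϑ a b : EuclideanSpace ℝ (Fin d)} (hA0 : 0 ≤ A)
    (hA : ∀ u ∈ segment ℝ a b, lyapunov ϑ p u ≤ A) {g : EuclideanSpace ℝ (Fin d) → ℝ}
    (hgV : ∀ y, |g y| ≤ lyapunov ϑ p y)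
    (ha : Integrable (fun z => g (a + t • z)) (stdGaussian (EuclideanSpace ℝ (Fin d))))
    (hb : Integrable (fun z => g (b + t • z)) (stdGaussian (EuclideanSpace ℝ (Fin d)))) :
    ‖∫ z, g (b + t • z) ∂(stdGaussian (EuclideanSpace ℝ (Fin d)))
        - ∫ z, g (a + t • z) ∂(stdGaussian (EuclideanSpace ℝ (Fin d)))‖ₑ
      ≤ ENNReal.ofReal (‖b - a‖ / t * (A + t ^ p *
        √((2 : ℝ) ^ p * (Real.Gamma (p + (d : ℝ) / 2) / Real.Gamma ((d : ℝ) / 2))))) := by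
  -- The displacement in units of the scale `t`, which reduces the problem to shifting a standard
  -- Gaussian.
  set h : EuclideanSpace ℝ (Fin d) := t⁻¹ • (b - a) with hh
  have hth : t • h = b - a := by rw [hh, smul_inv_smul₀ ht.ne']
  have hGb : ∀ z, b + t • z = a + t • (z + h) := fun z => by
    rw [smul_add, hth]
    abel
  simp_rw [hGb] at hb ⊢
  refine (enorm_integral_shift_stdGaussian_le (G := fun z => g (a + t • z))
    (W := fun z => ENNReal.ofReal (lyapunov ϑ p (a + t • z)))
    ((measurable_lyapunov ϑ p).comp (by fun_prop)).ennreal_ofReal (fun z => ?_) h ha hb).trans ?_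
  · rw [Real.enorm_eq_ofReal_abs]
    exact ENNReal.ofReal_le_ofReal (hgV _)
  have hW : ∀ r ∈ Ioc (0 : ℝ) 1, ∀ z, ENNReal.ofReal (lyapunov ϑ p (a + t • (z + r • h)))
      ≤ ENNReal.ofReal A + ENNReal.ofReal (t ^ p) * ENNReal.ofReal (‖z‖ ^ p) := by
    intro r hr z
    rw [← ENNReal.ofReal_mul (by positivity), ← ENNReal.ofReal_add hA0 (by positivity)]
    refine ENNReal.ofReal_le_ofReal ?_
    -- The intermediate centres run along the segment from `a` to `b`, so a bound on `V_p` there is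
    -- enough.
    have he : a + t • (z + r • h) = (a + r • (b - a)) + t • z := by
      rw [smul_add, smul_comm t r h, hth]
      abel
    rw [he]
    refine (lyapunov_add_le ϑ hp hp' _ _).trans (add_le_add (hA _ ?_) ?_)
    · rw [segment_eq_image']
      exact ⟨r, ⟨hr.1.le, hr.2⟩, rfl⟩
    · rw [norm_smul, Real.norm_of_nonneg ht.le, Real.mul_rpow ht.le (norm_nonneg _)]
  calc _ ≤ ∫⁻ _ in Ioc (0 : ℝ) 1, ENNReal.ofReal ‖h‖ * (ENNReal.ofReal A + ENNReal.ofReal (t ^ p) *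
        ENNReal.ofReal √((2 : ℝ) ^ p *
          (Real.Gamma (p + (d : ℝ) / 2) / Real.Gamma ((d : ℝ) / 2)))) := by
        refine setLIntegral_mono measurable_const fun r hr => ?_
        refine (lintegral_mono fun z => ?_).trans (lintegral_weight_mul_inner_le hd hp _ _ h)
        exact mul_le_mul_left (hW r hr z) _
    _ = _ := by
        rw [setLIntegral_const, Real.volume_Ioc, sub_zero, ENNReal.ofReal_one, mul_one,
          ← ENNReal.ofReal_mul (by positivity), ← ENNReal.ofReal_add hA0 (by positivity),
          ← ENNReal.ofReal_mul (norm_nonneg _), hh, norm_smul, norm_inv,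
          Real.norm_of_nonneg ht.le, inv_mul_eq_div]

/-- The effect of moving the center of a scaled rotationally invariant stable law. -/
theorem IsRotInvStable.enorm_integral_sub_le {d : ℕ} (hd : 0 < d) {α p σ A : ℝ} (hp : 0 < p)
    (hp' : p < 1) (hpα : p < α) (hα : α < 2) (hσ : 0 < σ)
    {ν : Measure (EuclideanSpace ℝ (Fin d))} [IsProbabilityMeasure ν] (hν : IsRotInvStable α ν)
    {ϑ a b : EuclideanSpace ℝ (Fin d)} (hA0 : 0 ≤ A)
    (hA : ∀ u ∈ segment ℝ a b, lyapunov ϑ p u ≤ A) {g : EuclideanSpace ℝ (Fin d) → ℝ}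
    (hg : Measurable g) (hgV : ∀ y, |g y| ≤ lyapunov ϑ p y) :
    ‖∫ z, g (b + σ • z) ∂ν - ∫ z, g (a + σ • z) ∂ν‖ₑ
      ≤ ENNReal.ofReal (‖b - a‖ / σ *
        (A * (Real.Gamma (1 + 1 / α) / Real.Gamma (3 / 2)) + σ ^ p *
        √((2 : ℝ) ^ p * (Real.Gamma (p + (d : ℝ) / 2) / Real.Gamma ((d : ℝ) / 2)))
          * (Real.Gamma ((1 + α - p) / α) / Real.Gamma ((3 - p) / 2)))) := by
  have hα0 : 0 < α := hp.trans hpα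
  obtain ⟨μ, hμ, hpos, hLap⟩ := exists_oneSidedStable (a := α / 2) (by linarith) (by linarith)
  set C := √((2 : ℝ) ^ p * (Real.Gamma (p + (d : ℝ) / 2) / Real.Gamma ((d : ℝ) / 2))) with hC
  set γ := stdGaussian (EuclideanSpace ℝ (Fin d)) with hγ
  have hmeas : Measurable (fun q : ℝ × EuclideanSpace ℝ (Fin d) => √(2 * q.1) • q.2) := by
    fun_prop
  have hνeq := hν.eq_map_prod hα0 hpos hLap
  have hgc : ∀ c : EuclideanSpace ℝ (Fin d), Measurable (fun z => g (c + σ • z)) := fun c =>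
    hg.comp (by fun_prop)
  have hint : ∀ c : EuclideanSpace ℝ (Fin d), Integrable
      (fun q : ℝ × EuclideanSpace ℝ (Fin d) => g (c + (σ * √(2 * q.1)) • q.2)) (μ.prod γ) := by
    intro c
    have h1 : Integrable (fun z => g (c + σ • z)) ν :=
      (integrable_lyapunov_affine hd hp hp'.le hpα hα hσ hν ϑ c).mono'
        (hgc c).aestronglyMeasurable (Eventually.of_forall fun z => hgV _)
    rw [hνeq, integrable_map_measure (hgc c).aestronglyMeasurable hmeas.aemeasurable] at h1
    refine h1.congr (Eventually.of_forall fun q => ?_)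
    simp only [Function.comp, smul_smul]
  have hval : ∀ c : EuclideanSpace ℝ (Fin d), ∫ z, g (c + σ • z) ∂ν
      = ∫ s, ∫ z, g (c + (σ * √(2 * s)) • z) ∂γ ∂μ := by
    intro c
    rw [hνeq, integral_map hmeas.aemeasurable (hgc c).aestronglyMeasurable,
      ← integral_prod _ (hint c)]
    simp only [smul_smul, hγ]
  rw [hval, hval, ← integral_sub (hint b).integral_prod_left (hint a).integral_prod_left]
  have hC0 : 0 ≤ C := Real.sqrt_nonneg _
  have hba : 0 ≤ ‖b - a‖ / σ := by positivity
  have hpt : ∀ᵐ s ∂μ, ‖∫ z, g (b + (σ * √(2 * s)) • z) ∂γ - ∫ z, g (a + (σ * √(2 * s)) • z) ∂γ‖ₑ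
      ≤ ENNReal.ofReal (‖b - a‖ / σ * A) * ENNReal.ofReal (s ^ (-(1 / 2 : ℝ)))
        + ENNReal.ofReal (‖b - a‖ / σ * (σ ^ p * C)) * ENNReal.ofReal (s ^ (-((1 - p) / 2))) := by
    filter_upwards [hpos, (hint a).prod_right_ae, (hint b).prod_right_ae] with s hs ha hb
    have ht : 0 < σ * √(2 * s) := by positivity
    refine (enorm_integral_gaussian_sub_le hd hp hp'.le ht hA0 hA hgV ha hb).trans ?_
    rw [← ENNReal.ofReal_mul (by positivity), ← ENNReal.ofReal_mul (by positivity),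
      ← ENNReal.ofReal_add (by positivity) (by positivity), ← hC]
    refine ENNReal.ofReal_le_ofReal ?_
    -- Replacing `2 * s` by `s` discards a factor `2 ^ (-(r / 2))`; the target constant leaves room
    -- for this.
    have h2 : ∀ r : ℝ, 0 ≤ r → √(2 * s) ^ (-r) ≤ s ^ (-(r / 2)) := by
      intro r hr
      have h3 : √s ^ (-r) = s ^ (-(r / 2)) := by
        rw [Real.sqrt_eq_rpow, ← Real.rpow_mul hs.le]
        congr 1
        ring
      rw [← h3]
      exact Real.rpow_le_rpow_of_nonpos (Real.sqrt_pos.2 hs)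
        (Real.sqrt_le_sqrt (by linarith)) (by linarith)
    have h4 := h2 1 zero_le_one
    have h5 := h2 (1 - p) (by linarith)
    have hq : 0 < √(2 * s) := by positivity
    have h6 : √(2 * s) ^ (-(1 - p)) = √(2 * s) ^ p * √(2 * s) ^ (-1 : ℝ) := by
      rw [← Real.rpow_add hq]
      congr 1
      ring
    calc ‖b - a‖ / (σ * √(2 * s)) * (A + (σ * √(2 * s)) ^ p * C)
        = ‖b - a‖ / σ * A * √(2 * s) ^ (-1 : ℝ)
          + ‖b - a‖ / σ * (σ ^ p * C) * √(2 * s) ^ (-(1 - p)) := by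
          rw [h6, Real.rpow_neg_one, Real.mul_rpow hσ.le hq.le]
          field_simp
      _ ≤ _ := by gcongr
  refine (enorm_integral_le_lintegral_enorm _).trans ((lintegral_mono_ae hpt).trans_eq ?_)
  have hΓ1 := Real.Gamma_pos_of_pos (show 0 < 1 + 1 / α by positivity)
  have hΓ2 := Real.Gamma_pos_of_pos (show (0 : ℝ) < 3 / 2 by norm_num)
  have hΓ3 := Real.Gamma_pos_of_pos (show 0 < (1 + α - p) / α from div_pos (by linarith) hα0)
  have hΓ4 := Real.Gamma_pos_of_pos (show 0 < (3 - p) / 2 by linarith)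
  rw [lintegral_add_left (by fun_prop), lintegral_const_mul _ (by fun_prop),
    lintegral_const_mul _ (by fun_prop),
    lintegral_rpow_neg_of_laplace hpos (by linarith) hLap (by norm_num),
    lintegral_rpow_neg_of_laplace hpos (by linarith) hLap (by linarith),
    show 1 + 1 / 2 / (α / 2) = 1 + 1 / α by field_simp,
    show (1 : ℝ) + 1 / 2 = 3 / 2 by norm_num,
    show 1 + (1 - p) / 2 / (α / 2) = (1 + α - p) / α by field_simp; ring,
    show 1 + (1 - p) / 2 = (3 - p) / 2 by ring,
    ← ENNReal.ofReal_mul (by positivity), ← ENNReal.ofReal_mul (by positivity),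
    ← ENNReal.ofReal_add (by positivity) (by positivity)]
  congr 1
  ring

/-! ### The drift of gradient descent -/

section Drift

variable {d n : ℕ} {S : Type*} [NormedAddCommGroup S] {𝒳 : Set S}
  {f : EuclideanSpace ℝ (Fin d) → S → ℝ} {K₁ K₂ B m K D η : ℝ} {X X' : Fin n → S}
  {ϑ : EuclideanSpace ℝ (Fin d)}

theorem PseudoLipschitzGradient.gradient_empiricalRisk
    (hLip : PseudoLipschitzGradient f 𝒳 K₁ K₂) (hX : ∀ i, X i ∈ 𝒳)
    (θ : EuclideanSpace ℝ (Fin d)) :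
    gradient (empiricalRisk f X) θ
      = (1 / (n : ℝ)) • ∑ i, gradient (fun w => f w (X i)) θ := by
  have hdiff : ∀ i, DifferentiableAt ℝ (fun w => f w (X i)) θ := fun i =>
    (hLip.differentiable (X i) (hX i)) θ
  have h : fderiv ℝ (empiricalRisk f X) θ
      = (1 / (n : ℝ)) • ∑ i, fderiv ℝ (fun w => f w (X i)) θ := by
    unfold empiricalRisk
    rw [fderiv_const_mul (DifferentiableAt.fun_sum fun i _ => hdiff i),
      fderiv_fun_sum fun i _ => hdiff i]
  simp only [gradient, h, map_smul, map_sum]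

/-- All summands but one cancel, which is the source of the factor `1 / n`. Both gradients are taken
at the same `θ`, so the `K₁` term vanishes. -/
theorem PseudoLipschitzGradient.norm_gradient_empiricalRisk_sub_le
    (hLip : PseudoLipschitzGradient f 𝒳 K₁ K₂) (hD : ∀ x ∈ 𝒳, ∀ x' ∈ 𝒳, ‖x - x'‖ ≤ D)
    (hX : ∀ i, X i ∈ 𝒳) (hX' : ∀ i, X' i ∈ 𝒳) (hXX' : Neighboring X X')
    (θ : EuclideanSpace ℝ (Fin d)) :
    ‖gradient (empiricalRisk f X) θ - gradient (empiricalRisk f X') θ‖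
      ≤ 1 / (n : ℝ) * (K₂ * D * (2 * ‖θ‖ + 1)) := by
  obtain ⟨i, hi⟩ := hXX'
  rw [hLip.gradient_empiricalRisk hX, hLip.gradient_empiricalRisk hX', ← smul_sub,
    ← Finset.sum_sub_distrib, Finset.sum_eq_single i (fun j _ hj => by rw [hi j hj, sub_self])
    (by simp), norm_smul, Real.norm_of_nonneg (by positivity)]
  refine mul_le_mul_of_nonneg_left ?_ (by positivity)
  have h1 := hLip.bound θ θ (X i) (hX i) (X' i) (hX' i)
  rw [sub_self, norm_zero, mul_zero, zero_add] at h1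
  refine h1.trans ?_
  have h2 := hD (X i) (hX i) (X' i) (hX' i)
  have := hLip.K₂_pos
  rw [show ‖θ‖ + ‖θ‖ + 1 = 2 * ‖θ‖ + 1 by ring]
  gcongr

theorem average_le_of_forall_le (hn : 0 < n) {c : Fin n → ℝ} {C : ℝ} (h : ∀ i, c i ≤ C) :
    1 / (n : ℝ) * ∑ i, c i ≤ C := by
  have hn' : (0 : ℝ) < n := by exact_mod_cast hn
  have h1 : ∑ i, c i ≤ n * C := by
    refine (Finset.sum_le_card_nsmul _ _ C fun i _ => h i).trans_eq ?_
    simp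
  rw [one_div, inv_mul_le_iff₀ hn']
  exact h1

theorem PseudoLipschitzGradient.norm_gradient_empiricalRisk_le
    (hLip : PseudoLipschitzGradient f 𝒳 K₁ K₂) (hϑ : IsUniversalStablePoint f 𝒳 ϑ) (hn : 0 < n)
    (hX : ∀ i, X i ∈ 𝒳) (θ : EuclideanSpace ℝ (Fin d)) :
    ‖gradient (empiricalRisk f X) θ‖ ≤ K₁ * ‖θ - ϑ‖ := by
  rw [hLip.gradient_empiricalRisk hX, norm_smul, Real.norm_of_nonneg (by positivity)]
  refine (mul_le_mul_of_nonneg_left (norm_sum_le _ _) (by positivity)).trans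
    (average_le_of_forall_le hn fun i => ?_)
  have h1 := hLip.bound θ ϑ (X i) (hX i) (X i) (hX i)
  rw [hϑ _ (hX i)] at h1
  simpa using h1

theorem UniformlyDissipative.le_inner_gradient_empiricalRisk
    (hDiss : UniformlyDissipative f 𝒳 B m K) (hLip : PseudoLipschitzGradient f 𝒳 K₁ K₂)
    (hϑ : IsUniversalStablePoint f 𝒳 ϑ) (hn : 0 < n)
    (hX : ∀ i, X i ∈ 𝒳) (θ : EuclideanSpace ℝ (Fin d)) :
    m * ‖θ - ϑ‖ ^ 2 - K ≤ inner ℝ (gradient (empiricalRisk f X) θ) (θ - ϑ) := by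
  rw [hLip.gradient_empiricalRisk hX, real_inner_smul_left, sum_inner, ← neg_le_neg_iff,
    ← mul_neg, ← Finset.sum_neg_distrib]
  refine average_le_of_forall_le hn fun i => ?_
  have h1 := hDiss.dissipative θ ϑ (X i) (hX i)
  rw [hϑ _ (hX i), sub_zero] at h1
  linarith

/-- Dissipativity and the Lipschitz property of the gradient force `m ≤ K₁`. -/
theorem UniformlyDissipative.le_lipschitz (hd : 0 < d)
    (hDiss : UniformlyDissipative f 𝒳 B m K) (hLip : PseudoLipschitzGradient f 𝒳 K₁ K₂)
    {x : S} (hx : x ∈ 𝒳) : m ≤ K₁ := by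
  by_contra hlt
  rw [not_le] at hlt
  set e : EuclideanSpace ℝ (Fin d) := EuclideanSpace.single ⟨0, hd⟩ (1 : ℝ)
  have he : ‖e‖ = 1 := by simp [e]
  -- If `K₁ < m`, Cauchy–Schwarz forces `(m - K₁) * t ^ 2 ≤ K` at every distance `t`; this choice
  -- makes the left side `K + 1`.
  set t : ℝ := √((K + 1) / (m - K₁))
  have hpos : 0 < m - K₁ := by linarith
  have hK := hDiss.K_pos
  have ht : ‖t • e - 0‖ ^ 2 = (K + 1) / (m - K₁) := by
    rw [sub_zero, norm_smul, he, mul_one, Real.norm_eq_abs, sq_abs,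
      Real.sq_sqrt (by positivity)]
  have h1 := hDiss.dissipative (t • e) 0 x hx
  have h2 := real_inner_le_norm
    (gradient (fun w => f w x) (t • e) - gradient (fun w => f w x) 0) (t • e - 0)
  have h3 := hLip.bound (t • e) 0 x hx x hx
  rw [sub_self x, norm_zero, mul_zero, zero_mul, add_zero] at h3
  have h4 := mul_le_mul_of_nonneg_right h3 (norm_nonneg (t • e - 0))
  have h5 : (m - K₁) * ‖t • e - 0‖ ^ 2 ≤ K := by nlinarith
  rw [ht, mul_div_cancel₀ _ hpos.ne'] at h5
  linarith

/-- Expand the square: dissipativity controls the cross term and the Lipschitz bound the quadratic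
one, both compared with the zero gradient at `ϑ`. -/
theorem norm_gradientStep_sub_sq_le (hη : 0 ≤ η)
    (hDiss : UniformlyDissipative f 𝒳 B m K) (hLip : PseudoLipschitzGradient f 𝒳 K₁ K₂)
    (hϑ : IsUniversalStablePoint f 𝒳 ϑ) (hn : 0 < n)
    (hX : ∀ i, X i ∈ 𝒳) (θ : EuclideanSpace ℝ (Fin d)) :
    ‖θ - η • gradient (empiricalRisk f X) θ - ϑ‖ ^ 2
      ≤ (1 - 2 * η * m + η ^ 2 * K₁ ^ 2) * ‖θ - ϑ‖ ^ 2 + 2 * η * K := by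
  have h1 := hDiss.le_inner_gradient_empiricalRisk hLip hϑ hn hX θ
  have h2 := hLip.norm_gradient_empiricalRisk_le hϑ hn hX θ
  set G := gradient (empiricalRisk f X) θ
  have h3 : ‖G‖ ^ 2 ≤ (K₁ * ‖θ - ϑ‖) ^ 2 := by gcongr
  rw [show θ - η • G - ϑ = (θ - ϑ) - η • G by abel, norm_sub_sq_real, real_inner_smul_right,
    norm_smul, mul_pow, Real.norm_eq_abs, sq_abs, real_inner_comm]
  have h4 := mul_le_mul_of_nonneg_left h1 hη
  have h5 := mul_le_mul_of_nonneg_left h3 (sq_nonneg η)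
  nlinarith

/-- Both centres satisfy the same drift bound, hence lie in one ball around `ϑ`; by convexity so
does the segment. Subadditivity of the power `p / 2` then splits the bound. -/
theorem lyapunov_segment_gradientStep_le (hd : 0 < d) {p : ℝ} (hp : 0 < p) (hp' : p ≤ 1)
    (hη : 0 ≤ η)
    (hDiss : UniformlyDissipative f 𝒳 B m K) (hLip : PseudoLipschitzGradient f 𝒳 K₁ K₂)
    (hϑ : IsUniversalStablePoint f 𝒳 ϑ) (hn : 0 < n)
    (hX : ∀ i, X i ∈ 𝒳) (hX' : ∀ i, X' i ∈ 𝒳) (θ : EuclideanSpace ℝ (Fin d))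
    {u : EuclideanSpace ℝ (Fin d)}
    (hu : u ∈ segment ℝ (θ - η • gradient (empiricalRisk f X') θ)
      (θ - η • gradient (empiricalRisk f X) θ)) :
    lyapunov ϑ p u ≤ 1 + (1 - 2 * η * m + η ^ 2 * K₁ ^ 2) ^ (p / 2) * (‖θ - ϑ‖ ^ 2) ^ (p / 2)
      + (2 * η * K) ^ (p / 2) := by
  have hm := hDiss.le_lipschitz hd hLip (hX ⟨0, hn⟩)
  have hK := hDiss.K_pos
  set ρ := 1 - 2 * η * m + η ^ 2 * K₁ ^ 2 with hρ
  -- From `m ≤ K₁` one gets `ρ ≥ (1 - η * K₁) ^ 2`, so no smallness of the step size is required.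
  have hρ0 : 0 ≤ ρ := by
    have := mul_le_mul_of_nonneg_left hm hη
    nlinarith [sq_nonneg (1 - η * K₁)]
  have hR0 : 0 ≤ ρ * ‖θ - ϑ‖ ^ 2 + 2 * η * K := by positivity
  have hball : ∀ Y : Fin n → S, (∀ i, Y i ∈ 𝒳) → θ - η • gradient (empiricalRisk f Y) θ
      ∈ Metric.closedBall ϑ (√(ρ * ‖θ - ϑ‖ ^ 2 + 2 * η * K)) := by
    intro Y hY
    rw [Metric.mem_closedBall, dist_eq_norm]
    exact Real.le_sqrt_of_sq_le (norm_gradientStep_sub_sq_le hη hDiss hLip hϑ hn hY θ)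
  have hu' := (convex_closedBall ϑ _).segment_subset (hball X' hX') (hball X hX) hu
  rw [Metric.mem_closedBall, dist_eq_norm, Real.le_sqrt (norm_nonneg _) hR0] at hu'
  have hq : 0 ≤ p / 2 := by linarith
  have hq' : p / 2 ≤ 1 := by linarith
  calc lyapunov ϑ p u ≤ (1 + ρ * ‖θ - ϑ‖ ^ 2 + 2 * η * K) ^ (p / 2) :=
        Real.rpow_le_rpow (by positivity) (by linarith) hq
    _ ≤ (1 + ρ * ‖θ - ϑ‖ ^ 2) ^ (p / 2) + (2 * η * K) ^ (p / 2) :=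
        Real.rpow_add_le_add_rpow (by positivity) (by positivity) hq hq'
    _ ≤ (1 ^ (p / 2) + (ρ * ‖θ - ϑ‖ ^ 2) ^ (p / 2)) + (2 * η * K) ^ (p / 2) := by
        gcongr
        exact Real.rpow_add_le_add_rpow zero_le_one (by positivity) hq hq'
    _ = _ := by rw [Real.one_rpow, Real.mul_rpow hρ0 (by positivity)]

end Drift

/-! ### The explicit constant -/

theorem Gamma_three_halves : Real.Gamma (3 / 2) = √Real.pi / 2 := by
  rw [show (3 / 2 : ℝ) = 1 / 2 + 1 by norm_num, Real.Gamma_add_one (by norm_num),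
    Real.Gamma_one_half_eq]
  ring

/-- Turns the growth `(2 * ‖θ‖ + 1) / 2` of the data perturbation into the weight `V_1`. -/
theorem norm_add_half_le {E : Type*} [SeminormedAddCommGroup E] (θ ϑ : E) :
    ‖θ‖ + 1 / 2 ≤ (2 + ‖ϑ‖) * (1 + ‖θ - ϑ‖ ^ 2) ^ (1 / 2 : ℝ) := by
  rw [← Real.sqrt_eq_rpow]
  have h1 : ‖θ‖ ≤ ‖θ - ϑ‖ + ‖ϑ‖ := by simpa using norm_add_le (θ - ϑ) ϑ
  have h2 : ‖θ - ϑ‖ ≤ √(1 + ‖θ - ϑ‖ ^ 2) := Real.le_sqrt_of_sq_le (by linarith)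
  have h3 : 1 ≤ √(1 + ‖θ - ϑ‖ ^ 2) := Real.one_le_sqrt.2 (by nlinarith [norm_nonneg (θ - ϑ)])
  nlinarith [norm_nonneg ϑ]

/-- Since `Γ(3/2) = √π / 2`, the factor `2 / √π * Γ(1 + 1/α)` is the moment of `S` of order `-1/2`,
the form in which it arises from subordination. -/
theorem cGamma_eq (d : ℕ) (α p η σ m K K₁ K₂ D : ℝ) (ϑ : EuclideanSpace ℝ (Fin d)) :
    cGamma d α p η σ m K K₁ K₂ D ϑ
      = 2 * (2 * K₂ * D * η / σ) *
        (Real.Gamma (1 + 1 / α) / Real.Gamma (3 / 2) *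
            ((1 - 2 * η * m + η ^ 2 * K₁ ^ 2) ^ (p / 2) + √2 + (2 * η * K) ^ (p / 2))
          + σ ^ p * √((2 : ℝ) ^ p * (Real.Gamma (p + (d : ℝ) / 2) / Real.Gamma ((d : ℝ) / 2)))
            * (Real.Gamma ((1 + α - p) / α) / Real.Gamma ((3 - p) / 2))) * (2 + ‖ϑ‖) := by
  rw [Gamma_three_halves]
  simp only [cGamma]
  ring

/-- The one-step bound in weighted total variation follows from the drift bounds. -/
theorem shift_bound_le_cGamma {d n : ℕ} {α p η σ m K K₁ K₂ D δ : ℝ} (hα : 1 < α) (hp : 0 < p)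
    (hp' : p < 1) (hη : 0 < η) (hσ : 0 < σ) (hK : 0 < K) (hK₂ : 0 < K₂) (hD : 0 ≤ D)
    (hρ : 0 ≤ 1 - 2 * η * m + η ^ 2 * K₁ ^ 2) (θ ϑ : EuclideanSpace ℝ (Fin d))
    (hδ : δ ≤ η * (1 / (n : ℝ) * (K₂ * D * (2 * ‖θ‖ + 1)))) :
    δ / σ * ((1 + (1 - 2 * η * m + η ^ 2 * K₁ ^ 2) ^ (p / 2) * (‖θ - ϑ‖ ^ 2) ^ (p / 2)
          + (2 * η * K) ^ (p / 2)) * (Real.Gamma (1 + 1 / α) / Real.Gamma (3 / 2)) + σ ^ p *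
        √((2 : ℝ) ^ p * (Real.Gamma (p + (d : ℝ) / 2) / Real.Gamma ((d : ℝ) / 2)))
          * (Real.Gamma ((1 + α - p) / α) / Real.Gamma ((3 - p) / 2)))
      ≤ cGamma d α p η σ m K K₁ K₂ D ϑ / n * lyapunov ϑ (1 + p) θ := by
  have hΓ1 := Real.Gamma_pos_of_pos (show 0 < 1 + 1 / α by positivity)
  have hΓ2 := Real.Gamma_pos_of_pos (show (0 : ℝ) < 3 / 2 by norm_num)
  have hΓ3 := Real.Gamma_pos_of_pos
    (show 0 < (1 + α - p) / α from div_pos (by linarith) (by linarith))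
  have hΓ4 := Real.Gamma_pos_of_pos (show 0 < (3 - p) / 2 by linarith)
  rw [cGamma_eq]
  set c₂ := Real.Gamma (1 + 1 / α) / Real.Gamma (3 / 2)
  set T := σ ^ p * √((2 : ℝ) ^ p * (Real.Gamma (p + (d : ℝ) / 2) / Real.Gamma ((d : ℝ) / 2)))
          * (Real.Gamma ((1 + α - p) / α) / Real.Gamma ((3 - p) / 2))
  set R := (1 - 2 * η * m + η ^ 2 * K₁ ^ 2) ^ (p / 2)
  set L := (2 * η * K) ^ (p / 2)
  have hc₂ : 0 ≤ c₂ := by positivity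
  have hT : 0 ≤ T := by positivity
  have hR : 0 ≤ R := by positivity
  have hL : 0 ≤ L := by positivity
  set v := (1 + ‖θ - ϑ‖ ^ 2) ^ (1 / 2 : ℝ) with hv
  set w := (1 + ‖θ - ϑ‖ ^ 2) ^ (p / 2) with hw
  have hv0 : 0 ≤ v := by positivity
  have hw1 : 1 ≤ w := Real.one_le_rpow (by nlinarith [norm_nonneg (θ - ϑ)]) (by linarith)
  have hrw : (‖θ - ϑ‖ ^ 2) ^ (p / 2) ≤ w :=
    Real.rpow_le_rpow (by positivity) (by linarith) (by linarith)
  have hV : lyapunov ϑ (1 + p) θ = v * w := by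
    rw [lyapunov, hv, hw, ← Real.rpow_add (by positivity)]
    congr 1
    ring
  have hδ' : δ / σ ≤ 2 * K₂ * D * η / σ / n * ((2 + ‖ϑ‖) * v) := by
    calc δ / σ ≤ η * (1 / (n : ℝ) * (K₂ * D * (2 * ‖θ‖ + 1))) / σ := by gcongr
      _ = 2 * K₂ * D * η / σ / n * (‖θ‖ + 1 / 2) := by ring
      _ ≤ _ := by
        gcongr
        exact norm_add_half_le θ ϑ
  have h2 : (1 : ℝ) ≤ √2 := Real.one_le_sqrt.2 (by norm_num)
  -- The factor `2` and the `√2` in place of `1` are slack: `w ≥ 1` would already give the bound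
  -- without them.
  have hin : (1 + R * (‖θ - ϑ‖ ^ 2) ^ (p / 2) + L) * c₂ + T
      ≤ 2 * (c₂ * (R + √2 + L) + T) * w := by
    have h3 : 1 + R * (‖θ - ϑ‖ ^ 2) ^ (p / 2) + L ≤ (R + √2 + L) * w := by
      have h4 := mul_le_mul_of_nonneg_left hrw hR
      have h5 : 1 ≤ √2 * w := one_le_mul_of_one_le_of_one_le h2 hw1
      have h6 := mul_le_mul_of_nonneg_left hw1 hL
      nlinarith
    have h4 := mul_le_mul_of_nonneg_right h3 hc₂
    have h5 := mul_le_mul_of_nonneg_left hw1 hT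
    have h6 : 0 ≤ c₂ * (R + √2 + L) * w := by positivity
    have h7 : 0 ≤ T * w := by positivity
    nlinarith
  rw [hV]
  calc _ ≤ 2 * K₂ * D * η / σ / n * ((2 + ‖ϑ‖) * v) * (2 * (c₂ * (R + √2 + L) + T) * w) := by
        refine mul_le_mul hδ' hin (by positivity) (by positivity)
    _ = _ := by ring

theorem cGamma_pos {d : ℕ} {α p η σ m K K₁ K₂ D : ℝ} (hα : 1 < α) (hp' : p < 1) (hη : 0 < η)
    (hσ : 0 < σ) (hK : 0 < K) (hK₂ : 0 < K₂) (hD : 0 < D)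
    (hρ : 0 ≤ 1 - 2 * η * m + η ^ 2 * K₁ ^ 2) (ϑ : EuclideanSpace ℝ (Fin d)) :
    0 < cGamma d α p η σ m K K₁ K₂ D ϑ := by
  have hΓ1 := Real.Gamma_pos_of_pos (show 0 < 1 + 1 / α by positivity)
  have hΓ2 := Real.Gamma_pos_of_pos (show (0 : ℝ) < 3 / 2 by norm_num)
  have hΓ3 := Real.Gamma_pos_of_pos
    (show 0 < (1 + α - p) / α from div_pos (by linarith) (by linarith))
  have hΓ4 := Real.Gamma_pos_of_pos (show 0 < (3 - p) / 2 by linarith)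
  rw [cGamma_eq]
  positivity

end

end HeavyTailedGD

/-! ### The one-step perturbation bound. -/

theorem mainTheorem6 {d n : ℕ} (hd : 0 < d)
    {S : Type*} [NormedAddCommGroup S] [NormedSpace ℝ S] (𝒳 : Set S)
    (f : EuclideanSpace ℝ (Fin d) → S → ℝ)
    (α p η σ : ℝ) (hα : 1 < α) (hα' : α < 2) (hp : 0 < p) (hp' : p < min (1 / 2) (α - 1))
    (hη : 0 < η) (hσ : 0 < σ)
    (ν : Measure (EuclideanSpace ℝ (Fin d))) [IsProbabilityMeasure ν]
    (hν : HeavyTailedGD.IsRotInvStable α ν)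
    (K₁ K₂ B m K D : ℝ)
    (hLip : HeavyTailedGD.PseudoLipschitzGradient f 𝒳 K₁ K₂)
    (hDiss : HeavyTailedGD.UniformlyDissipative f 𝒳 B m K)
    (hD : ∀ x ∈ 𝒳, ∀ x' ∈ 𝒳, ‖x - x'‖ ≤ D)
    (ϑ : EuclideanSpace ℝ (Fin d)) (hϑ : HeavyTailedGD.IsUniversalStablePoint f 𝒳 ϑ)
    (X X' : Fin n → S) (hX : ∀ i, X i ∈ 𝒳) (hX' : ∀ i, X' i ∈ 𝒳)
    (hXX' : HeavyTailedGD.Neighboring X X') :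
    (0 < D → 0 < HeavyTailedGD.cGamma d α p η σ m K K₁ K₂ D ϑ) ∧
    (∀ θ, Integrable (HeavyTailedGD.lyapunov ϑ p) (HeavyTailedGD.gdKernel f η σ ν X θ) ∧
      Integrable (HeavyTailedGD.lyapunov ϑ p) (HeavyTailedGD.gdKernel f η σ ν X' θ)) ∧
    (⨆ θ, HeavyTailedGD.vNorm (HeavyTailedGD.lyapunov ϑ p)
          (HeavyTailedGD.gdKernel f η σ ν X θ) (HeavyTailedGD.gdKernel f η σ ν X' θ)
        / ENNReal.ofReal (HeavyTailedGD.lyapunov ϑ (1 + p) θ))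
      ≤ ENNReal.ofReal (HeavyTailedGD.cGamma d α p η σ m K K₁ K₂ D ϑ / n) := by
  have hp1 : p < 1 / 2 := hp'.trans_le (min_le_left _ _)
  have hp2 : p < 1 := by linarith
  -- `Neighboring` supplies an index even when the data sets coincide, so the sample is nonempty.
  have hn : 0 < n := Fin.pos hXX'.choose
  have hK := hDiss.K_pos
  have hm := hDiss.le_lipschitz hd hLip (hX ⟨0, hn⟩)
  have hρ : 0 ≤ 1 - 2 * η * m + η ^ 2 * K₁ ^ 2 := by
    have := mul_le_mul_of_nonneg_left hm hη.le
    nlinarith [sq_nonneg (1 - η * K₁)]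
  have hD0 : 0 ≤ D := (norm_nonneg _).trans (hD _ (hX ⟨0, hn⟩) _ (hX ⟨0, hn⟩))
  have hstep : ∀ (Y : Fin n → S) (θ : EuclideanSpace ℝ (Fin d)),
      Measurable (HeavyTailedGD.gdStep f η σ Y θ) := fun Y θ =>
    (HeavyTailedGD.measurable_gdStep f η σ Y).comp measurable_prodMk_left
  refine ⟨fun hDpos => HeavyTailedGD.cGamma_pos hα hp2 hη hσ hK hLip.K₂_pos hDpos hρ ϑ, ?_, ?_⟩
  · have hint : ∀ (Y : Fin n → S) (θ : EuclideanSpace ℝ (Fin d)),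
        Integrable (HeavyTailedGD.lyapunov ϑ p) (HeavyTailedGD.gdKernel f η σ ν Y θ) := by
      intro Y θ
      refine (integrable_map_measure
        (HeavyTailedGD.measurable_lyapunov ϑ p).aestronglyMeasurable
        (hstep Y θ).aemeasurable).2 ?_
      exact HeavyTailedGD.integrable_lyapunov_affine hd hp hp2.le (by linarith) hα' hσ hν ϑ _
    exact fun θ => ⟨hint X θ, hint X' θ⟩
  · refine iSup_le fun θ => ?_
    have hV := HeavyTailedGD.lyapunov_pos ϑ (1 + p) θ
    refine ENNReal.div_le_of_le_mul ?_
    rw [← ENNReal.ofReal_mul' hV.le]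
    refine iSup_le fun g => iSup_le fun hg => iSup_le fun hgV => ?_
    have hmap : ∀ Y : Fin n → S, ∫ y, g y ∂(HeavyTailedGD.gdKernel f η σ ν Y θ)
        = ∫ z, g (θ - η • gradient (HeavyTailedGD.empiricalRisk f Y) θ + σ • z) ∂ν := fun Y =>
      integral_map (hstep Y θ).aemeasurable hg.aestronglyMeasurable
    rw [hmap, hmap, ← Real.enorm_eq_ofReal_abs]
    refine (hν.enorm_integral_sub_le hd hp hp2 (by linarith) hα' hσ (by positivity)
      (fun u hu => HeavyTailedGD.lyapunov_segment_gradientStep_le hd hp hp2.le hη.le hDiss hLip hϑ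
        hn hX hX' θ hu) hg hgV).trans (ENNReal.ofReal_le_ofReal ?_)
    refine HeavyTailedGD.shift_bound_le_cGamma hα hp hp2 hη hσ hK hLip.K₂_pos hD0 hρ θ ϑ ?_
    rw [sub_sub_sub_cancel_left, ← smul_sub, norm_smul, Real.norm_of_nonneg hη.le, norm_sub_rev]
    exact mul_le_mul_of_nonneg_left
      (hLip.norm_gradient_empiricalRisk_sub_le hD hX hX' hXX' θ) hη.le
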